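/- Let $d\in\mathbb N$, $\varepsilon>0$, $T>0$, and let $V_{\mathrm b}:\mathbb R^d\to\mathbb R$ be continuous and bounded. A *Schrödinger solution* is a function $\phi\in C([0,T];L^2(\mathbb R^d))$ that solves $$\mathrm i\varepsilon\,\partial_t\phi=-\tfrac{\varepsilon^2}{2}\Delta_x\phi+V_{\mathrm b}\phi$$ in the sense of tempered distributions in $x$ (for every Schwartz function $\chi$, $t\mapsto\int\phi(t)\chi$ is differentiable on $[0,T]$ with the derivative prescribed by the equation). A *Wigner solution* is a function $f\in C([0,T];L^2(\mathbb R^{2d}))$ that solves, in the same sense, $$\partial_t f+k\cdot\nabla_x f=\mathcal L_{V_{\mathrm b}}[f],\qquad \mathcal L_{V}[f](x,k)=\frac{\mathrm i}{(2\pi)^d}\int_{\mathbb R^{2d}}\frac{V(x+\frac{\varepsilon}{2}y)-V(x-\frac{\varepsilon}{2}y)}{\varepsilon}\,f(x,p)\,e^{\mathrm i y\cdot(k-p)}\,\mathrm dy\,\mathrm dp .$$ (The operator $\mathcal L_V$ is moved onto the test function by its anti-symmetry.) For $\phi_1,\phi_2\in L^2(\mathbb R^d)$ put $\langle\phi_1,\phi_2\rangle=\int\phi_1\overline{\phi_2}\,\mathrm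 dx$ and $$W[\phi_1,\phi_2](x,k)=\frac1{(2\pi)^d}\int_{\mathbb R^d}e^{\mathrm i k\cdot y}\,\phi_1\!\left(x-\tfrac{\varepsilon}{2}y\right)\overline{\phi_2}\!\left(x+\tfrac{\varepsilon}{2}y\right)\mathrm dy .$$ If $\phi_{\mathrm b}$ and $\psi$ are Schrödinger solutions with $\phi_{\mathrm b}(0)=\phi_{\mathrm I}$ and $\psi(T)=\psi_T$, the Schrödinger representative is $$R_{\mathrm S}[\phi_{\mathrm I},\psi_T]=\frac1{\mathrm i\varepsilon}\int_0^T\phi_{\mathrm b}(t)\,\overline{\psi(t)}\,\mathrm dt\in L^1(\mathbb R^d).$$ If $f_{\mathrm b}$ and $g$ are Wigner solutions with $f_{\mathrm b}(0)=f_{\mathrm I}$ and $g(T)=g_T$, the Wigner representative is $$R_{\mathrm W}[f_{\mathrm I},g_T](x)=\frac{\mathrm i}{(2\pi)^d}\int_{\mathbb R^{3d}\times[0,T]}e^{\mathrm i p\cdot(z-x)}\,\overline{g}(t,z,k)\,\frac{f_{\mathrm b}(t,z,k+\frac{\varepsilon}{2}p)-f_{\mathrm b}(t,z,k-\frac{\varepsilon}{2}p)}{\varepsilon}\,\mathrm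 dp\,\mathrm dz\,\mathrm dk\,\mathrm dt .$$ This is an oscillatory integral that defines a distribution in $x$: it is paired with a Schwartz function of $x$, the $x$-integral being carried out first. **Theorem.** Let $\phi_{\mathrm b},\phi_{\mathrm b}',\psi,\psi'$ be Schrödinger solutions with $\phi_{\mathrm b}(0)=\phi_{\mathrm I}$, $\phi_{\mathrm b}'(0)=\phi_{\mathrm I}'$, $\psi(T)=\psi_T$, $\psi'(T)=\psi_T'$, where $\phi_{\mathrm I},\phi_{\mathrm I}',\psi_T,\psi_T'\in L^2(\mathbb R^d)$. Let $f_{\mathrm I}=W[\phi_{\mathrm I},\psi'(0)]$ and $g_T=W[\psi_T,\phi_{\mathrm b}'(T)]$. Then there are a unique Wigner solution $f_{\mathrm b}$ with $f_{\mathrm b}(0)=f_{\mathrm I}$ and a unique Wigner solution $g$ with $g(T)=g_T$, and $$(2\pi\varepsilon)^d\,R_{\mathrm W}[f_{\mathrm I},g_T]=\langle\phi_{\mathrm I}',\psi'(0)\rangle\,R_{\mathrm S}[\phi_{\mathrm I},\psi_T]-\langle\phi_{\mathrm I},\psi(0)\rangle\,R_{\mathrm S}[\phi_{\mathrm I}',\psi_T']$$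 as distributions on $\mathbb R^d$. If moreover the integral over $(z,k,t)$ in $R_{\mathrm W}$ is integrable as a function of $p$, the identity holds for almost every $x$, with $R_{\mathrm W}(x)$ the iterated integral. In particular, every Wigner representative with data $f_{\mathrm I},g_T$ of this form is a linear combination of Schrödinger representatives. -/

import Mathlib

open MeasureTheory
open scoped ENNReal BoundedContinuousFunction ComplexConjugate

noncomputable section

namespace InverseWigner

/-- The configuration space `ℝ^d` with its Euclidean structure. -/
abbrev Pos (d : ℕ) : Type := EuclideanSpace ℝ (Fin d)

/-- The phase space `ℝ^d × ℝ^d`; a point is a pair `(x, k)`. -/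
abbrev Phase (d : ℕ) : Type := Pos d × Pos d

/-- `L²(ℝ^d)`, the space of wave functions. -/
abbrev WaveSpace (d : ℕ) : Type := Lp ℂ 2 (volume : Measure (Pos d))

/-- `L²(ℝ^{2d})`, the space of functions on phase space. -/
abbrev PhaseSpaceL2 (d : ℕ) : Type := Lp ℂ 2 (volume : Measure (Phase d))

/-- `e^{i θ}` for a real number `θ`. -/
def cis (θ : ℝ) : ℂ := Complex.exp (Complex.I * θ)

/-- `φ` is a solution in `C([0,T]; L²)` of the Schrödinger equation
`i ε ∂ₜ φ = - (ε² / 2) Δ φ + V φ` on `[0, T]`, in the sense of (tempered) distributions in `x`: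
for every test function `χ`, the function `t ↦ ∫ φ(t) χ` is differentiable on `[0, T]` and
`d/dt ∫ φ(t) χ = (1 / (i ε)) ∫ φ(t) (- (ε² / 2) Δ χ + V χ)`. -/
structure IsSchrodingerSolution {d : ℕ} (ε T : ℝ) (V : Pos d →ᵇ ℝ) (φ : ℝ → WaveSpace d) :
    Prop where
  continuousOn : ContinuousOn φ (Set.Icc 0 T)
  weak : ∀ χ : SchwartzMap (Pos d) ℂ, ∀ t ∈ Set.Icc 0 T,
    HasDerivWithinAt (fun s : ℝ => ∫ x, φ s x * χ x)
      ((1 / (Complex.I * ε)) *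
        ∫ x, φ t x * (-((ε : ℂ) ^ 2 / 2) * Laplacian.laplacian χ x + (V x : ℂ) * χ x))
      (Set.Icc 0 T) t

/-- The Wigner transform
`W[φ₁, φ₂](x, k) = (2π)^{-d} ∫ e^{i k·y} φ₁(x - (ε/2) y) conj (φ₂(x + (ε/2) y)) dy`.
For square integrable `φ₁`, `φ₂` and `ε ≠ 0` the integrand is integrable for every `(x, k)`. -/
def wignerTransform {d : ℕ} (ε : ℝ) (φ₁ φ₂ : WaveSpace d) (w : Phase d) : ℂ :=
  (1 / (2 * Real.pi : ℂ) ^ d) *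
    ∫ y : Pos d, cis (inner ℝ w.2 y) * φ₁ (w.1 - (ε / 2) • y) * conj (φ₂ (w.1 + (ε / 2) • y))

/-- The difference quotient `δ[V](x, y) = (V(x + (ε/2) y) - V(x - (ε/2) y)) / ε`. -/
def potentialDiff {d : ℕ} (ε : ℝ) (V : Pos d →ᵇ ℝ) (x y : Pos d) : ℝ :=
  (1 / ε) * (V (x + (ε / 2) • y) - V (x - (ε / 2) • y))

/-- The Wigner potential operator on a test function `χ` on phase space,
`L_V[χ](x, k) = i (2π)^{-d} ∫ ∫ δ[V](x, y) χ(x, p) e^{i y·(k - p)} dp dy`,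
where the inner integral in `p` is a Schwartz function of `y`. -/
def wignerOp {d : ℕ} (ε : ℝ) (V : Pos d →ᵇ ℝ) (χ : SchwartzMap (Phase d) ℂ) (w : Phase d) : ℂ :=
  (Complex.I / (2 * Real.pi : ℂ) ^ d) *
    ∫ y : Pos d, ∫ p : Pos d,
      (potentialDiff ε V w.1 y : ℂ) * χ (w.1, p) * cis (inner ℝ y (w.2 - p))

/-- The transport derivative `k · ∇ₓ χ` of a test function on phase space. -/
def transport {d : ℕ} (χ : SchwartzMap (Phase d) ℂ) (w : Phase d) : ℂ :=
  fderiv ℝ (χ : Phase d → ℂ) w (w.2, 0)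

/-- `f` is a solution in `C([0,T]; L²(ℝ^{2d}))` of the Wigner equation
`∂ₜ f + k · ∇ₓ f = L_V[f]` on `[0, T]`, in the sense of (tempered) distributions in `(x, k)`.
Both `k · ∇ₓ` and `L_V` are skew for the pairing `∫ f χ`, so that for every test function `χ`
`d/dt ∫ f(t) χ = ∫ f(t) (k · ∇ₓ χ - L_V[χ])`. -/
structure IsWignerSolution {d : ℕ} (ε T : ℝ) (V : Pos d →ᵇ ℝ) (f : ℝ → PhaseSpaceL2 d) :
    Prop where
  continuousOn : ContinuousOn f (Set.Icc 0 T)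
  weak : ∀ χ : SchwartzMap (Phase d) ℂ, ∀ t ∈ Set.Icc 0 T,
    HasDerivWithinAt (fun s : ℝ => ∫ w, f s w * χ w)
      (∫ w, f t w * (transport χ w - wignerOp ε V χ w))
      (Set.Icc 0 T) t

/-- The product `φ · conj ψ` of two square integrable functions, as an element of `L¹(ℝ^d)`. -/
def mulConj {d : ℕ} (φ ψ : WaveSpace d) : Lp ℂ 1 (volume : Measure (Pos d)) :=
  Integrable.toL1 (fun x => φ x * conj (ψ x))
    (by simpa [RCLike.inner_apply] using L2.integrable_inner (𝕜 := ℂ) ψ φ)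

/-- The Schrödinger representative `R_S = (1 / (i ε)) ∫₀ᵀ φ(t) conj (ψ(t)) dt`, an element of
`L¹(ℝ^d)`, for a background solution `φ` and an adjoint solution `ψ`. -/
def schrodingerRep {d : ℕ} (ε T : ℝ) (φ ψ : ℝ → WaveSpace d) :
    Lp ℂ 1 (volume : Measure (Pos d)) :=
  (1 / (Complex.I * ε)) • ∫ t in (0 : ℝ)..T, mulConj (φ t) (ψ t)

/-- The distribution `χ ↦ ∫ h χ` given by an integrable function `h`. -/
def toDistribution {d : ℕ} (h : Lp ℂ 1 (volume : Measure (Pos d))) (χ : SchwartzMap (Pos d) ℂ) :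
    ℂ :=
  ∫ x, h x * χ x

/-- The difference quotient
`D f(z, k, p) = (f(z, k + (ε/2) p) - f(z, k - (ε/2) p)) / ε`. -/
def phaseDiff {d : ℕ} (ε : ℝ) (f : PhaseSpaceL2 d) (z k p : Pos d) : ℂ :=
  (1 / (ε : ℂ)) * (f (z, k + (ε / 2) • p) - f (z, k - (ε / 2) • p))

/-- The Wigner representative
`R_W(x) = i (2π)^{-d} ∫ e^{i p·(z - x)} conj (g(z, k)) D f(z, k, p) dp dz dk dt` over
`ℝ^{3d} × [0, T]`, for a background solution `f` and an adjoint solution `g`, as a distribution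
in `x`. The integral is an oscillatory one: it is paired with a test function `χ`, the integral in
`x` being done first, which makes it absolutely convergent. -/
def wignerRep {d : ℕ} (ε T : ℝ) (f g : ℝ → PhaseSpaceL2 d) (χ : SchwartzMap (Pos d) ℂ) : ℂ :=
  (Complex.I / (2 * Real.pi : ℂ) ^ d) *
    ∫ p : Pos d, ∫ t in (0 : ℝ)..T, ∫ w : Phase d,
      (∫ x : Pos d, cis (inner ℝ p (w.1 - x)) * χ x) *
        conj (g t w) * phaseDiff ε (f t) w.1 w.2 p

/-- The integral over `(z, k, t)` in the Wigner representative at the point `x`, as a function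
of `p`. -/
def wignerRepIntegrand {d : ℕ} (ε T : ℝ) (f g : ℝ → PhaseSpaceL2 d) (x p : Pos d) : ℂ :=
  ∫ t in (0 : ℝ)..T, ∫ w : Phase d,
    cis (inner ℝ p (w.1 - x)) * conj (g t w) * phaseDiff ε (f t) w.1 w.2 p

/-- The Wigner representative at the point `x`, as an iterated integral. It is meaningful when
`wignerRepIntegrand ε T f g x` is integrable in `p`, a condition that does not depend on `x`. -/
def wignerRepAt {d : ℕ} (ε T : ℝ) (f g : ℝ → PhaseSpaceL2 d) (x : Pos d) : ℂ :=
  (Complex.I / (2 * Real.pi : ℂ) ^ d) * ∫ p : Pos d, wignerRepIntegrand ε T f g x p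

/-- The set of all Schrödinger representatives for the background potential `V`,
as distributions. -/
def schrodingerReps {d : ℕ} (ε T : ℝ) (V : Pos d →ᵇ ℝ) : Set (SchwartzMap (Pos d) ℂ → ℂ) :=
  {S | ∃ φ ψ : ℝ → WaveSpace d, IsSchrodingerSolution ε T V φ ∧ IsSchrodingerSolution ε T V ψ ∧
    S = toDistribution (schrodingerRep ε T φ ψ)}

end InverseWigner

end

/-!
In Fourier variables the free flow is multiplication by a unimodular phase. Undoing it turns a weak
Schrödinger solution into a differentiable curve in `L²`, generated by the bounded operator
`(i ε)⁻¹ V` conjugated by the free flow; hence `⟨φ(t), ψ(t)⟩` is conserved.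

Integrated against `W[φ, ψ]`, a test function acts on `φ ⊗ ψ̄` by averaging the reflections
`u ↦ e^{i b·u} φ(a - u)`. The free flow conjugates these by the shear `(x, k) ↦ (x + s k, k)`, so
that `W` intertwines the free flow with free transport, while Plancherel's theorem in `k` turns the
commutator with `V` into `L_V`. Therefore `W[φ(t), ψ(t)]` is a Wigner solution. It is the only one
with its value at a given time: pulled back along free transport, the difference of two solutions
has a derivative bounded, by duality, by its own `L²` norm, and a contraction on short time
intervals forces it to vanish.

In the representative, Parseval's identity in `k` replaces both Wigner transforms by products of
wave functions at the endpoints `x ∓ (ε/2) y` of a chord, and the shift of `k` by `±(ε/2) p`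
concentrates the phase `e^{i p·x}` on a single endpoint. In the coordinates given by the endpoints
the integral factorises into an inner product, which is conserved and leaves the time integral, and
the Fourier transform of a product `φ ψ̄`, which Fourier inversion in `p` undoes.
-/

open FourierTransform Filter Topology
open scoped ContDiff

noncomputable section

namespace InverseWigner

/-! ### Unimodular phases -/

lemma cis_add (a b : ℝ) : cis (a + b) = cis a * cis b := by
  simp [cis, mul_add, Complex.exp_add]

@[simp] lemma norm_cis (a : ℝ) : ‖cis a‖ = 1 := by
  rw [cis, mul_comm, Complex.norm_exp_ofReal_mul_I]

lemma conj_cis (a : ℝ) : conj (cis a) = cis (-a) := by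
  simp [cis, ← Complex.exp_conj]

lemma fourierChar_eq_cis (a : ℝ) : (Real.fourierChar a : ℂ) = cis (2 * Real.pi * a) := by
  rw [Real.fourierChar_apply, cis, mul_comm]

lemma contDiff_cis {n : WithTop ℕ∞} : ContDiff ℝ n cis :=
  Complex.contDiff_exp.comp (contDiff_const.mul Complex.ofRealCLM.contDiff)

@[fun_prop] lemma continuous_cis : Continuous cis := (contDiff_cis (n := 0)).continuous

lemma hasDerivAt_cis (θ : ℝ) : HasDerivAt cis (Complex.I * cis θ) θ := by
  unfold cis
  simpa [mul_comm] using ((hasDerivAt_id θ).ofReal_comp.const_mul Complex.I).cexp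

lemma iteratedDeriv_cis (n : ℕ) : iteratedDeriv n cis = fun θ => Complex.I ^ n * cis θ := by
  induction n with
  | zero => simp
  | succ n ih =>
    funext θ
    rw [iteratedDeriv_succ, ih, ((hasDerivAt_cis θ).const_mul _).deriv, pow_succ, mul_assoc]

@[fun_prop] lemma hasTemperateGrowth_cis : cis.HasTemperateGrowth :=
  ⟨contDiff_cis, fun n => ⟨0, 1, fun θ => by
    simp [norm_iteratedFDeriv_eq_norm_iteratedDeriv, iteratedDeriv_cis]⟩⟩

/-! ### `L²` functions and their bilinear pairing -/

section L2

variable {α : Type*} [MeasurableSpace α] {μ : Measure α}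

lemma lintegral_enorm_sq {E : Type*} [NormedAddCommGroup E] (f : α → E) :
    ∫⁻ x, ‖f x‖ₑ ^ 2 ∂μ = eLpNorm f 2 μ ^ 2 := by
  simpa using (eLpNorm_nnreal_pow_eq_lintegral (f := f) (μ := μ) (two_ne_zero (α := NNReal))).symm

lemma memLp_two_iff_lintegral_lt_top {E : Type*} [NormedAddCommGroup E] {f : α → E}
    (hf : AEStronglyMeasurable f μ) : MemLp f 2 μ ↔ ∫⁻ x, ‖f x‖ₑ ^ 2 ∂μ < ⊤ := by
  rw [MemLp, and_iff_right hf, lintegral_enorm_sq, ENNReal.pow_lt_top_iff]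
  simp

lemma tendsto_toLp_of_dominated {ι E : Type*} [NormedAddCommGroup E] {p : ℝ≥0∞} [Fact (1 ≤ p)]
    (hp : p ≠ ⊤) {l : Filter ι} [l.IsCountablyGenerated] {u : ι → α → E} {v : α → E} {G : α → ℝ}
    (hu : ∀ i, MemLp (u i) p μ) (hv : MemLp v p μ) (hG : MemLp G p μ)
    (hle : ∀ᶠ i in l, ∀ᵐ x ∂μ, ‖u i x‖ ≤ G x)
    (hlim : ∀ᵐ x ∂μ, Tendsto (fun i => u i x) l (𝓝 (v x))) :
    Tendsto (fun i => (hu i).toLp) l (𝓝 hv.toLp) := by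
  have hp0 : p ≠ 0 := (zero_lt_one.trans_le Fact.out).ne'
  have hr : 0 < p.toReal := ENNReal.toReal_pos hp0 hp
  have hH : MemLp (fun x => G x + ‖v x‖) p μ := hG.add hv.norm
  rw [Lp.tendsto_Lp_iff_tendsto_eLpNorm'']
  simp only [eLpNorm_eq_lintegral_rpow_enorm_toReal hp0 hp, Pi.sub_apply]
  suffices h : Tendsto (fun i => ∫⁻ x, ‖u i x - v x‖ₑ ^ p.toReal ∂μ) l (𝓝 0) by
    simpa [hr] using h.ennrpow_const (1 / p.toReal)
  rw [← lintegral_zero (μ := μ)]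
  refine tendsto_lintegral_filter_of_dominated_convergence'
    (fun x => ‖G x + ‖v x‖‖ₑ ^ p.toReal) ?_ ?_ ?_ ?_
  · exact .of_forall fun i => ((hu i).1.sub hv.1).enorm.pow_const _
  · filter_upwards [hle] with i hi
    filter_upwards [hi] with x hx
    refine ENNReal.rpow_le_rpow (enorm_le_iff_norm_le.2 ?_) hr.le
    calc ‖u i x - v x‖ ≤ ‖u i x‖ + ‖v x‖ := norm_sub_le _ _
      _ ≤ G x + ‖v x‖ := by gcongr
      _ ≤ ‖G x + ‖v x‖‖ := le_abs_self _
  · exact (lintegral_rpow_enorm_lt_top_of_eLpNorm_lt_top hp0 hp hH.2).ne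
  · filter_upwards [hlim] with x hx
    have hx0 : Tendsto (fun i => u i x - v x) l (𝓝 0) := by simpa using hx.sub_const (v x)
    simpa [hr] using hx0.enorm.ennrpow_const p.toReal

/-- The bilinear pairing `∫ f g` on `L²`, through which weak solutions are tested. -/
def pairing (μ : Measure α) : Lp ℂ 2 μ →L[ℂ] Lp ℂ 2 μ →L[ℂ] ℂ :=
  (ContinuousLinearMap.mul ℂ ℂ).lpPairing μ 2 2

lemma pairing_apply (f g : Lp ℂ 2 μ) : pairing μ f g = ∫ x, f x * g x ∂μ :=
  ContinuousLinearMap.lpPairing_eq_integral _ _ _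

lemma pairing_toLp (f : Lp ℂ 2 μ) {g : α → ℂ} (hg : MemLp g 2 μ) :
    pairing μ f hg.toLp = ∫ x, f x * g x ∂μ := by
  rw [pairing_apply]
  exact integral_congr_ae (hg.coeFn_toLp.mono fun x hx => by simp only [hx])

lemma norm_star_Lp (f : Lp ℂ 2 μ) : ‖star f‖ = ‖f‖ := by
  rw [Lp.norm_def, Lp.norm_def, eLpNorm_congr_ae (Lp.coeFn_star f), eLpNorm_star]

lemma pairing_star (f g : Lp ℂ 2 μ) : pairing μ f (star g) = inner ℂ g f := by
  rw [pairing_apply, L2.inner_def]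
  exact integral_congr_ae ((Lp.coeFn_star g).mono fun x hx => by
    simp only [hx, Pi.star_apply, RCLike.inner_apply, RCLike.star_def])

lemma norm_pairing_le (f g : Lp ℂ 2 μ) : ‖pairing μ f g‖ ≤ ‖f‖ * ‖g‖ := by
  rw [← star_star g, pairing_star, norm_star_Lp, mul_comm]
  exact norm_inner_le_norm _ _

end L2

/-! ### Testing against Schwartz functions -/

section Test

variable {E : Type*} [NormedAddCommGroup E] [NormedSpace ℝ E] [FiniteDimensional ℝ E]
  [MeasurableSpace E] [BorelSpace E] {μ : Measure E}

lemma ae_eq_of_forall_integral_mul_schwartz {f g : E → ℂ}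
    (hf : LocallyIntegrable f μ) (hg : LocallyIntegrable g μ)
    (h : ∀ χ : SchwartzMap E ℂ, ∫ x, f x * χ x ∂μ = ∫ x, g x * χ x ∂μ) : f =ᵐ[μ] g := by
  refine ae_eq_of_integral_contDiff_smul_eq hf hg fun η hη hs => ?_
  have hs' : HasCompactSupport fun x => (η x : ℂ) := hs.comp_left (g := ((↑) : ℝ → ℂ)) rfl
  have hη' : ContDiff ℝ ∞ fun x => (η x : ℂ) := Complex.ofRealCLM.contDiff.comp hη
  have htest : ∫ x, f x * η x ∂μ = ∫ x, g x * η x ∂μ := h (hs'.toSchwartzMap hη')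
  simpa only [Complex.real_smul, mul_comm] using htest

variable [μ.HasTemperateGrowth] [IsFiniteMeasureOnCompacts μ]

lemma norm_le_of_forall_schwartz {h : Lp ℂ 2 μ} {M : ℝ} (hM0 : 0 ≤ M)
    (hM : ∀ χ : SchwartzMap E ℂ, ‖∫ x, h x * χ x ∂μ‖ ≤ M * ‖χ.toLp 2 μ‖) : ‖h‖ ≤ M := by
  have hpair : ∀ g : Lp ℂ 2 μ, ‖pairing μ h g‖ ≤ M * ‖g‖ := fun g =>
    (SchwartzMap.denseRange_toLpCLM (F := ℂ) (p := 2) (μ := μ) ENNReal.ofNat_ne_top).induction_on g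
      (isClosed_le (by fun_prop) (by fun_prop))
      fun χ => (congrArg norm (pairing_toLp h (χ.memLp 2 μ))).trans_le (hM χ)
  have hsq := hpair (star h)
  rw [pairing_star, norm_star_Lp, inner_self_eq_norm_sq_to_K, norm_pow, RCLike.norm_ofReal,
    abs_norm, sq] at hsq
  rcases (norm_nonneg h).eq_or_lt with h0 | hpos
  · exact h0 ▸ hM0
  · exact le_of_mul_le_mul_right hsq hpos

end Test

/-! ### The Fourier integral -/

section Fourier

open Module

section Smul

variable {E : Type*} [NormedAddCommGroup E] [NormedSpace ℝ E] [FiniteDimensional ℝ E]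
  [MeasurableSpace E] [BorelSpace E] {μ : Measure E} [μ.IsAddHaarMeasure] {r : ℝ}

lemma lintegral_comp_smul (hr : r ≠ 0) (f : E → ℝ≥0∞) :
    ∫⁻ x, f (r • x) ∂μ = ENNReal.ofReal |(r ^ finrank ℝ E)⁻¹| * ∫⁻ x, f x ∂μ := by
  rw [← smul_eq_mul, ← lintegral_smul_measure, ← Measure.map_addHaar_smul μ hr]
  exact (lintegral_map_equiv f (Homeomorph.smulOfNeZero r hr).toMeasurableEquiv).symm

lemma memLp_comp_smul {F : Type*} [NormedAddCommGroup F] {p : ℝ≥0∞} (hr : r ≠ 0) {f : E → F}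
    (hf : MemLp f p μ) : MemLp (fun x => f (r • x)) p μ := by
  have hmap : MemLp f p (μ.map (r • ·)) := by
    rw [Measure.map_addHaar_smul μ hr]
    exact hf.smul_measure ENNReal.ofReal_ne_top
  exact hmap.comp_of_map (by fun_prop)

end Smul

variable {E : Type*} [NormedAddCommGroup E] [InnerProductSpace ℝ E] [FiniteDimensional ℝ E]
  [MeasurableSpace E] [BorelSpace E]

lemma integral_fourierIntegral_mul {e : AddChar ℝ Circle} (he : Continuous e) {f g : E → ℂ}
    (hf : Integrable f) (hg : Integrable g) :
    ∫ x, VectorFourier.fourierIntegral e volume (-innerₗ E) f x * g x =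
      ∫ x, f x * VectorFourier.fourierIntegral e volume (-innerₗ E) g x := by
  have hflip : (-innerₗ E).flip = -innerₗ E := by
    ext x y
    simp [real_inner_comm]
  simpa only [hflip, smul_eq_mul] using VectorFourier.integral_fourierIntegral_smul_eq_flip
    (L := -innerₗ E) he continuous_inner.neg hf hg

lemma continuous_fourierInv {f : E → ℂ} (hf : Integrable f) : Continuous (𝓕⁻ f) :=
  VectorFourier.fourierIntegral_continuous (L := -innerₗ E) Real.continuous_fourierChar
    continuous_inner.neg hf

lemma coeFn_fourierInv_toLp {f : E → ℂ} (hf : Integrable f) (hf2 : MemLp f 2) :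
    (𝓕⁻ hf2.toLp : Lp ℂ 2 (volume : Measure E)) =ᵐ[volume] 𝓕⁻ f := by
  refine ae_eq_of_forall_integral_mul_schwartz ((Lp.memLp _).locallyIntegrable one_le_two)
    (continuous_fourierInv hf).locallyIntegrable fun χ => ?_
  have htempered := DFunLike.congr_fun (Lp.fourierInv_toTemperedDistribution_eq hf2.toLp) χ
  simp only [TemperedDistribution.fourierInv_apply, Lp.toTemperedDistribution_apply,
    SchwartzMap.fourierInv_coe, smul_eq_mul, mul_comm] at htempered
  calc ∫ x, (𝓕⁻ hf2.toLp : Lp ℂ 2 (volume : Measure E)) x * χ x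
      = ∫ x, hf2.toLp f x * 𝓕⁻ (χ : E → ℂ) x := htempered.symm
    _ = ∫ x, f x * 𝓕⁻ (χ : E → ℂ) x :=
      integral_congr_ae (hf2.coeFn_toLp.mono fun x hx => by simp only [hx])
    _ = ∫ x, 𝓕⁻ f x * χ x :=
      (integral_fourierIntegral_mul Real.continuous_fourierChar hf χ.integrable).symm

lemma memLp_fourierInv {f : E → ℂ} (hf : Integrable f) (hf2 : MemLp f 2) : MemLp (𝓕⁻ f) 2 :=
  (memLp_congr_ae (coeFn_fourierInv_toLp hf hf2)).1 (Lp.memLp _)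

lemma toLp_fourierInv {f : E → ℂ} (hf : Integrable f) (hf2 : MemLp f 2) :
    (memLp_fourierInv hf hf2).toLp = 𝓕⁻ hf2.toLp :=
  Lp.ext ((memLp_fourierInv hf hf2).coeFn_toLp.trans (coeFn_fourierInv_toLp hf hf2).symm)

/-- The Fourier integral `k ↦ ∫ e^{i k·y} f(y) dy`, with neither the `2π` in the exponent of
`𝓕⁻` nor a normalising factor in front: the convention of the Wigner transform. -/
def oscIntegral (f : E → ℂ) (k : E) : ℂ := ∫ y, cis (inner ℝ k y) * f y

lemma oscIntegral_eq_fourierIntegral (f : E → ℂ) :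
    oscIntegral f = VectorFourier.fourierIntegral Real.probChar volume (-innerₗ E) f := by
  ext k
  simp [oscIntegral, cis, VectorFourier.fourierIntegral, Circle.smul_def, Real.probChar_apply,
    real_inner_comm, mul_comm]

lemma fourierInv_eq_oscIntegral (f : E → ℂ) (k : E) :
    𝓕⁻ f k = oscIntegral f ((2 * Real.pi) • k) := by
  simp only [Real.fourierInv_eq, oscIntegral, Circle.smul_def, fourierChar_eq_cis,
    inner_smul_left, smul_eq_mul, real_inner_comm k, RCLike.conj_to_real]

lemma oscIntegral_eq_fourierInv (f : E → ℂ) (k : E) :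
    oscIntegral f k = 𝓕⁻ f ((2 * Real.pi)⁻¹ • k) := by
  rw [fourierInv_eq_oscIntegral, smul_inv_smul₀ (by positivity)]

lemma oscIntegral_comp_neg (f : E → ℂ) (k : E) :
    oscIntegral (fun y => f (-y)) k = oscIntegral f (-k) := by
  rw [oscIntegral, ← integral_neg_eq_self]
  simp only [oscIntegral, neg_neg, inner_neg_left, inner_neg_right]

lemma conj_oscIntegral (f : E → ℂ) (k : E) :
    conj (oscIntegral f k) = oscIntegral (fun y => conj (f y)) (-k) := by
  simp only [oscIntegral, ← integral_conj, map_mul, conj_cis, inner_neg_left]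

lemma continuous_oscIntegral {f : E → ℂ} (hf : Integrable f) : Continuous (oscIntegral f) := by
  rw [oscIntegral_eq_fourierIntegral]
  exact VectorFourier.fourierIntegral_continuous Real.continuous_probChar
    continuous_inner.neg hf

lemma integral_oscIntegral_mul {f g : E → ℂ} (hf : Integrable f) (hg : Integrable g) :
    ∫ x, oscIntegral f x * g x = ∫ x, f x * oscIntegral g x := by
  simpa only [oscIntegral_eq_fourierIntegral] using
    integral_fourierIntegral_mul Real.continuous_probChar hf hg

lemma memLp_oscIntegral {f : E → ℂ} (hf : Integrable f) (hf2 : MemLp f 2) :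
    MemLp (oscIntegral f) 2 :=
  (memLp_comp_smul (inv_ne_zero Real.two_pi_pos.ne') (memLp_fourierInv hf hf2)).congr_norm
    (continuous_oscIntegral hf).aestronglyMeasurable
    (ae_of_all _ fun k => by rw [oscIntegral_eq_fourierInv])

lemma abs_inv_two_pi_inv_pow (n : ℕ) : |(((2 * Real.pi)⁻¹ : ℝ) ^ n)⁻¹| = (2 * Real.pi) ^ n := by
  rw [inv_pow, inv_inv, abs_of_pos (by positivity)]

lemma lintegral_enorm_sq_oscIntegral {f : E → ℂ} (hf : Integrable f) (hf2 : MemLp f 2) :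
    ∫⁻ k, ‖oscIntegral f k‖ₑ ^ 2 =
      ENNReal.ofReal ((2 * Real.pi) ^ finrank ℝ E) * ∫⁻ y, ‖f y‖ₑ ^ 2 := by
  have hnorm : ‖𝓕⁻ hf2.toLp‖ₑ = ‖hf2.toLp‖ₑ :=
    (Lp.fourierTransformₗᵢ E ℂ).symm.toLinearIsometry.enorm_map _
  rw [← toLp_fourierInv hf hf2, Lp.enorm_toLp, Lp.enorm_toLp] at hnorm
  simp only [oscIntegral_eq_fourierInv]
  rw [lintegral_comp_smul (inv_ne_zero Real.two_pi_pos.ne') fun k => ‖𝓕⁻ f k‖ₑ ^ 2,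
    abs_inv_two_pi_inv_pow, lintegral_enorm_sq, lintegral_enorm_sq, hnorm]

lemma integral_conj_mul_eq_inner {α : Type*} [MeasurableSpace α] {μ : Measure α} {f g : α → ℂ}
    (hf : MemLp f 2 μ) (hg : MemLp g 2 μ) :
    ∫ x, conj (f x) * g x ∂μ = inner ℂ hf.toLp hg.toLp := by
  rw [L2.inner_def]
  refine integral_congr_ae ?_
  filter_upwards [hf.coeFn_toLp, hg.coeFn_toLp] with x hfx hgx
  rw [hfx, hgx, RCLike.inner_apply, mul_comm]

lemma integral_conj_oscIntegral_mul_oscIntegral {f g : E → ℂ} (hf : Integrable f)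
    (hf2 : MemLp f 2) (hg : Integrable g) (hg2 : MemLp g 2) :
    ∫ k, conj (oscIntegral f k) * oscIntegral g k =
      (2 * Real.pi : ℂ) ^ finrank ℝ E * ∫ y, conj (f y) * g y := by
  have hinner : inner ℂ (𝓕⁻ hf2.toLp) (𝓕⁻ hg2.toLp) = inner ℂ hf2.toLp hg2.toLp :=
    (Lp.fourierTransformₗᵢ E ℂ).symm.inner_map_map _ _
  rw [← toLp_fourierInv hf hf2, ← toLp_fourierInv hg hg2] at hinner
  simp only [oscIntegral_eq_fourierInv]
  rw [Measure.integral_comp_smul volume fun k => conj (𝓕⁻ f k) * 𝓕⁻ g k, abs_inv_two_pi_inv_pow,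
    integral_conj_mul_eq_inner (memLp_fourierInv hf hf2) (memLp_fourierInv hg hg2), hinner,
    integral_conj_mul_eq_inner hf2 hg2, Complex.real_smul]
  push_cast
  rfl

lemma integral_oscIntegral_mul_oscIntegral {f g : E → ℂ} (hf : Integrable f) (hf2 : MemLp f 2)
    (hg : Integrable g) (hg2 : MemLp g 2) :
    ∫ k, oscIntegral f k * oscIntegral g k =
      (2 * Real.pi : ℂ) ^ finrank ℝ E * ∫ y, f (-y) * g y := by
  have hneg := Measure.measurePreserving_neg (volume : Measure E)
  have hconj := integral_conj_oscIntegral_mul_oscIntegral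
    (Complex.conjCLE.integrable_comp_iff.2 hf.comp_neg)
    (hf2.comp_measurePreserving hneg).star hg hg2
  simpa only [Function.comp_def, Pi.star_apply, RCLike.star_def, Complex.conjCLE_apply,
    conj_oscIntegral, Complex.conj_conj, oscIntegral_comp_neg, neg_neg] using hconj

section Schwartz

variable (χ : SchwartzMap E ℂ)

lemma oscIntegral_neg_eq_fourier (y : E) :
    oscIntegral χ (-y) = 𝓕 χ ((2 * Real.pi)⁻¹ • y) := by
  rw [oscIntegral_eq_fourierInv, Real.fourierInv_eq_fourier_neg, smul_neg, neg_neg,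
    SchwartzMap.fourier_coe]

lemma integrable_oscIntegral_neg : Integrable fun y => oscIntegral χ (-y) := by
  simp only [oscIntegral_neg_eq_fourier]
  exact (𝓕 χ).integrable.comp_smul (inv_ne_zero Real.two_pi_pos.ne')

lemma oscIntegral_oscIntegral_neg (k : E) :
    oscIntegral (fun y => oscIntegral χ (-y)) k = (2 * Real.pi : ℂ) ^ finrank ℝ E * χ k := by
  have hscale := Measure.integral_comp_smul (volume : Measure E)
    (fun y => cis (inner ℝ ((2 * Real.pi) • k) y) * 𝓕 χ y) (2 * Real.pi)⁻¹
  rw [abs_inv_two_pi_inv_pow] at hscale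
  have hinv : 𝓕⁻ (𝓕 χ) k = χ k := by rw [fourierInv_fourier_eq]
  rw [SchwartzMap.fourierInv_coe, fourierInv_eq_oscIntegral] at hinv
  simp only [inner_smul_left, inner_smul_right, RCLike.conj_to_real, ← mul_assoc,
    inv_mul_cancel₀ Real.two_pi_pos.ne', one_mul, Complex.real_smul] at hscale
  simp only [oscIntegral_neg_eq_fourier]
  rw [← hinv, oscIntegral, hscale, oscIntegral]
  simp only [inner_smul_left, RCLike.conj_to_real]
  push_cast
  rfl

end Schwartz

end Fourier

/-! ### Weak evolution equations in `L²` -/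

section Evolution

lemma hasDerivWithinAt_clm_apply₂ {F G H : Type*} [NormedAddCommGroup F] [NormedSpace ℝ F]
    [NormedAddCommGroup G] [NormedSpace ℝ G] [NormedAddCommGroup H] [NormedSpace ℝ H]
    (B : F →L[ℝ] G →L[ℝ] H) {f : ℝ → F} {c : ℝ → G} {c' : G} {D : H} {s : Set ℝ} {t : ℝ}
    (hf : ContinuousWithinAt f s t) (hc : HasDerivWithinAt c c' s t)
    (hD : HasDerivWithinAt (fun τ => B (f τ) (c t)) D s t) :
    HasDerivWithinAt (fun τ => B (f τ) (c τ)) (D + B (f t) c') s t := by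
  have hincr : HasDerivWithinAt (fun τ => B (f τ) (c τ - c t)) (B (f t) c') s t := by
    rw [hasDerivWithinAt_iff_tendsto_slope] at hc ⊢
    have hBf : Tendsto (fun τ => B (f τ)) (𝓝[s \ {t}] t) (𝓝 (B (f t))) :=
      (B.continuous.tendsto _).comp (hf.mono_left (nhdsWithin_mono t Set.sdiff_subset))
    refine ((isBoundedBilinearMap_apply.continuous.tendsto _).comp
      (hBf.prodMk_nhds hc)).congr fun τ => ?_
    simp only [Function.comp_apply, slope_def_module, sub_self, map_zero, sub_zero, map_smul]
  refine (hD.add hincr).congr_of_eventuallyEq (.of_forall fun τ => ?_) ?_ <;>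
    simp only [Pi.add_apply, map_sub, add_sub_cancel]

lemma hasDerivWithinAt_toLp {α E : Type*} [MeasurableSpace α] {μ : Measure α}
    [NormedAddCommGroup E] [NormedSpace ℝ E] {p : ℝ≥0∞} [Fact (1 ≤ p)] (hp : p ≠ ⊤)
    {c c' : ℝ → α → E} {G : α → ℝ} {s : Set ℝ} {t : ℝ} (hs : Convex ℝ s) (ht : t ∈ s)
    (hc : ∀ τ, MemLp (c τ) p μ) (hc' : MemLp (c' t) p μ) (hG : MemLp G p μ)
    (hderiv : ∀ τ ∈ s, ∀ x, HasDerivWithinAt (fun τ => c τ x) (c' τ x) s τ)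
    (hle : ∀ τ ∈ s, ∀ x, ‖c' τ x‖ ≤ G x) :
    HasDerivWithinAt (fun τ => (hc τ).toLp) hc'.toLp s t := by
  rw [hasDerivWithinAt_iff_tendsto_slope]
  have hslope : ∀ τ, MemLp (fun x => slope (fun τ => c τ x) t τ) p μ := fun τ =>
    ((hc τ).sub (hc t)).const_smul (τ - t)⁻¹
  have hslope_toLp : ∀ τ, slope (fun τ => (hc τ).toLp) t τ = (hslope τ).toLp := fun τ => by
    rw [slope_def_module, ← MemLp.toLp_sub, ← MemLp.toLp_const_smul]
    rfl
  simp only [funext hslope_toLp]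
  refine tendsto_toLp_of_dominated hp hslope hc' hG ?_ (ae_of_all _ fun x =>
    hasDerivWithinAt_iff_tendsto_slope.1 (hderiv t ht x))
  filter_upwards [self_mem_nhdsWithin] with τ hτ
  refine ae_of_all _ fun x => ?_
  rw [slope_def_module, norm_smul, norm_inv,
    inv_mul_le_iff₀ (norm_pos_iff.2 (sub_ne_zero.2 hτ.2)), mul_comm]
  exact hs.norm_image_sub_le_of_norm_hasDerivWithin_le (fun σ hσ => hderiv σ hσ x)
    (fun σ hσ => hle σ hσ x) ht hτ.1

lemma hasDerivWithinAt_integral_mul {α : Type*} [MeasurableSpace α] {μ : Measure α}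
    {f : ℝ → Lp ℂ 2 μ} {c c' : ℝ → α → ℂ} {G : α → ℝ} {s : Set ℝ} {t : ℝ} {D : ℂ}
    (hs : Convex ℝ s) (ht : t ∈ s) (hf : ContinuousWithinAt f s t)
    (hc : ∀ τ, MemLp (c τ) 2 μ) (hc' : MemLp (c' t) 2 μ) (hG : MemLp G 2 μ)
    (hderiv : ∀ τ ∈ s, ∀ x, HasDerivWithinAt (fun τ => c τ x) (c' τ x) s τ)
    (hle : ∀ τ ∈ s, ∀ x, ‖c' τ x‖ ≤ G x)
    (hD : HasDerivWithinAt (fun τ => ∫ x, f τ x * c t x ∂μ) D s t) :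
    HasDerivWithinAt (fun τ => ∫ x, f τ x * c τ x ∂μ) (D + ∫ x, f t x * c' t x ∂μ) s t := by
  have hpair : ∀ (u : Lp ℂ 2 μ) (τ : ℝ), ∫ x, u x * c τ x ∂μ = pairing μ u (hc τ).toLp :=
    fun u τ => (pairing_toLp u (hc τ)).symm
  rw [← pairing_toLp _ hc']
  simp only [hpair] at hD ⊢
  exact hasDerivWithinAt_clm_apply₂ ((pairing μ).bilinearRestrictScalars ℝ) hf
    (hasDerivWithinAt_toLp ENNReal.ofNat_ne_top hs ht hc hc' hG hderiv hle) hD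

lemma hasDerivWithinAt_of_weak {E : Type*} [NormedAddCommGroup E] [NormedSpace ℝ E]
    [FiniteDimensional ℝ E] [MeasurableSpace E] [BorelSpace E] {μ : Measure E}
    [μ.HasTemperateGrowth] [IsFiniteMeasureOnCompacts μ] {b r : ℝ → Lp ℂ 2 μ} {s : Set ℝ}
    (hs : Convex ℝ s) {t : ℝ} (ht : t ∈ s) (hr : ContinuousWithinAt r s t)
    (hweak : ∀ χ : SchwartzMap E ℂ, ∀ τ ∈ s,
      HasDerivWithinAt (fun τ => ∫ x, b τ x * χ x ∂μ) (∫ x, r τ x * χ x ∂μ) s τ) :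
    HasDerivWithinAt b (r t) s t := by
  rw [hasDerivWithinAt_iff_isLittleO, Asymptotics.isLittleO_iff]
  intro δ hδ
  obtain ⟨ρ, hρ, hball⟩ := Metric.continuousWithinAt_iff.1 hr δ hδ
  filter_upwards [inter_mem_nhdsWithin s (Metric.ball_mem_nhds t hρ)] with τ hτ
  refine norm_le_of_forall_schwartz (by positivity) fun χ => ?_
  obtain ⟨P, hP, hPle⟩ : ∃ P : Lp ℂ 2 μ →L[ℝ] ℂ, (∀ u : Lp ℂ 2 μ, ∫ x, u x * χ x ∂μ = P u) ∧
      ∀ u, ‖P u‖ ≤ ‖u‖ * ‖χ.toLp 2 μ‖ :=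
    ⟨((pairing μ).flip (χ.toLp 2 μ)).restrictScalars ℝ,
      fun u => (pairing_toLp u (χ.memLp 2 μ)).symm, fun u => norm_pairing_le u _⟩
  have hweakχ := hweak χ
  simp only [hP] at hweakχ ⊢
  have hlinear : ∀ σ : ℝ, HasDerivAt (fun σ : ℝ => σ • P (r t)) (P (r t)) σ := fun σ => by
    simpa only [one_smul] using! (hasDerivAt_id' σ).smul_const (P (r t))
  have hderiv : ∀ σ ∈ s ∩ Metric.ball t ρ, HasDerivWithinAt (fun σ => P (b σ) - σ • P (r t))
      (P (r σ) - P (r t)) (s ∩ Metric.ball t ρ) σ := fun σ hσ =>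
    ((hweakχ σ hσ.1).mono Set.inter_subset_left).sub (hlinear σ).hasDerivWithinAt
  have hbound : ∀ σ ∈ s ∩ Metric.ball t ρ, ‖P (r σ) - P (r t)‖ ≤ δ * ‖χ.toLp 2 μ‖ :=
    fun σ hσ => by
      rw [← map_sub]
      refine (hPle _).trans ?_
      gcongr
      exact (dist_eq_norm (r σ) (r t)).symm.trans_le (hball hσ.1 hσ.2).le
  have hmean := (hs.inter (convex_ball t ρ)).norm_image_sub_le_of_norm_hasDerivWithin_le hderiv
    hbound ⟨ht, Metric.mem_ball_self hρ⟩ hτ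
  calc ‖P (b τ - b t - (τ - t) • r t)‖
      = ‖P (b τ) - τ • P (r t) - (P (b t) - t • P (r t))‖ := by
        simp only [map_sub, map_smul, sub_smul]
        congr 1
        ring
    _ ≤ δ * ‖τ - t‖ * ‖χ.toLp 2 μ‖ := hmean.trans_eq (by ring)

lemma eq_zero_of_norm_le_mul_abs_sub_of_le_half {H : Type*} [NormedAddCommGroup H] {h : ℝ → H}
    {C : ℝ} {s t : ℝ} (hC : 0 ≤ C) (hcont : ContinuousOn h (Set.uIcc s t))
    (hle : ∀ r ∈ Set.uIcc s t, ∀ M, (∀ σ ∈ Set.uIcc s r, ‖h σ‖ ≤ M) → ‖h r‖ ≤ C * |r - s| * M)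
    (hst : C * |t - s| ≤ 1 / 2) : h t = 0 := by
  obtain ⟨r, hr, hmax⟩ := isCompact_uIcc.exists_isMaxOn Set.nonempty_uIcc hcont.norm
  have hr2 : ‖h r‖ ≤ 1 / 2 * ‖h r‖ := by
    refine (hle r hr ‖h r‖ fun σ hσ => hmax (Set.uIcc_subset_uIcc_left hr hσ)).trans ?_
    gcongr
    exact (mul_le_mul_of_nonneg_left (Set.abs_sub_left_of_mem_uIcc hr) hC).trans hst
  have ht_le : ‖h t‖ ≤ ‖h r‖ := hmax Set.right_mem_uIcc
  exact norm_le_zero_iff.1 (by linarith)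

lemma eqOn_zero_of_norm_le_mul_abs_sub {H : Type*} [NormedAddCommGroup H] {h : ℝ → H} {C : ℝ}
    {I : Set ℝ} (hI : Convex ℝ I) (hC : 0 ≤ C) (hcont : ContinuousOn h I)
    (hle : ∀ s ∈ I, h s = 0 → ∀ t ∈ I, ∀ M, (∀ r ∈ Set.uIcc s t, ‖h r‖ ≤ M) →
      ‖h t‖ ≤ C * |t - s| * M)
    {t₀ : ℝ} (ht₀ : t₀ ∈ I) (h₀ : h t₀ = 0) : Set.EqOn h 0 I := by
  have hshort : ∀ s ∈ I, h s = 0 → ∀ t ∈ I, C * |t - s| ≤ 1 / 2 → h t = 0 :=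
    fun s hs hs0 t ht hst =>
      have hsub : Set.uIcc s t ⊆ I := hI.ordConnected.uIcc_subset hs ht
      eq_zero_of_norm_le_mul_abs_sub_of_le_half hC (hcont.mono hsub)
        (fun r hr => hle s hs hs0 r (hsub hr)) hst
  have hlong : ∀ (n : ℕ), ∀ t ∈ I, C * |t - t₀| ≤ n / 2 → h t = 0 := by
    intro n
    induction n with
    | zero =>
      intro t ht htn
      exact hshort t₀ ht₀ h₀ t ht (htn.trans (by norm_num))
    | succ n ih =>
      intro t ht htn
      push_cast at htn
      have hn : (0 : ℝ) < n + 1 := by positivity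
      have hs : t₀ + (n / (n + 1) : ℝ) • (t - t₀) ∈ I :=
        hI.add_smul_sub_mem ht₀ ht ⟨by positivity, (div_le_one hn).2 (by linarith)⟩
      refine hshort _ hs (ih _ hs ?_) t ht ?_
      · rw [add_sub_cancel_left, smul_eq_mul, abs_mul, abs_of_nonneg (by positivity)]
        calc C * (n / (n + 1) * |t - t₀|) = n / (n + 1) * (C * |t - t₀|) := by ring
          _ ≤ n / (n + 1) * ((n + 1) / 2) := by gcongr
          _ = n / 2 := by field_simp
      · have hrest : t - (t₀ + (n / (n + 1) : ℝ) • (t - t₀)) = 1 / (n + 1) * (t - t₀) := by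
          rw [smul_eq_mul]
          field_simp
          ring
        rw [hrest, abs_mul, abs_of_nonneg (by positivity)]
        calc C * (1 / (n + 1) * |t - t₀|) = 1 / (n + 1) * (C * |t - t₀|) := by ring
          _ ≤ 1 / (n + 1) * ((n + 1) / 2) := by gcongr
          _ = 1 / 2 := by field_simp
  intro t ht
  obtain ⟨n, hn⟩ := exists_nat_ge (2 * (C * |t - t₀|))
  exact hlong n t ht (by linarith)

end Evolution

/-! ### Multiplication operators -/

section MulOp

variable {α : Type*} [MeasurableSpace α] {μ : Measure α} {m : α → ℂ}

/-- Multiplication by an `L^∞` function, as an operator on `L²`. -/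
def mulOp (hm : MemLp m ⊤ μ) : Lp ℂ 2 μ →L[ℂ] Lp ℂ 2 μ :=
  (ContinuousLinearMap.mul ℂ ℂ).holderL μ ⊤ 2 2 hm.toLp

lemma coeFn_mulOp (hm : MemLp m ⊤ μ) (f : Lp ℂ 2 μ) : mulOp hm f =ᵐ[μ] fun x => m x * f x := by
  filter_upwards [(ContinuousLinearMap.mul ℂ ℂ).coeFn_holder (r := 2) hm.toLp f, hm.coeFn_toLp]
    with x hholder hmx
  rw [← hmx]
  exact hholder

lemma integral_mulOp_mul (hm : MemLp m ⊤ μ) (f : Lp ℂ 2 μ) (g : α → ℂ) :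
    ∫ x, mulOp hm f x * g x ∂μ = ∫ x, f x * (m x * g x) ∂μ :=
  integral_congr_ae ((coeFn_mulOp hm f).mono fun x hx => by simp only [hx]; ring)

lemma inner_mulOp_mulOp (hm : MemLp m ⊤ μ) (hunit : ∀ x, ‖m x‖ = 1) (f g : Lp ℂ 2 μ) :
    inner ℂ (mulOp hm f) (mulOp hm g) = inner ℂ f g := by
  rw [L2.inner_def, L2.inner_def]
  refine integral_congr_ae ?_
  filter_upwards [coeFn_mulOp hm f, coeFn_mulOp hm g] with x hf hg
  have hmx : m x * conj (m x) = 1 := by simp [Complex.mul_conj, Complex.normSq_eq_norm_sq, hunit]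
  rw [hf, hg, RCLike.inner_apply, RCLike.inner_apply, map_mul]
  linear_combination (g x * conj (f x)) * hmx

lemma norm_mulOp_le (hm : MemLp m ⊤ μ) {C : ℝ} (hC : ∀ x, ‖m x‖ ≤ C) (f : Lp ℂ 2 μ) :
    ‖mulOp hm f‖ ≤ C * ‖f‖ :=
  Lp.norm_le_mul_norm_of_ae_le_mul ((coeFn_mulOp hm f).mono fun x hx => by
    rw [hx, norm_mul]
    exact mul_le_mul_of_nonneg_right (hC x) (norm_nonneg _))

lemma continuousOn_mulOp {X : Type*} [TopologicalSpace X] [FirstCountableTopology X]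
    {m : X → α → ℂ} (hm : ∀ t, MemLp (m t) ⊤ μ) {C : ℝ} (hC : ∀ t x, ‖m t x‖ ≤ C)
    (hcont : ∀ x, Continuous fun t => m t x) {u : X → Lp ℂ 2 μ} {s : Set X}
    (hu : ContinuousOn u s) : ContinuousOn (fun t => mulOp (hm t) (u t)) s := by
  intro t ht
  have hmul : ∀ τ, MemLp (fun x => m τ x * u t x) 2 μ := fun τ => (Lp.memLp (u t)).mul' (hm τ)
  have hmulOp : ∀ τ, mulOp (hm τ) (u t) = (hmul τ).toLp := fun τ =>
    Lp.ext ((coeFn_mulOp (hm τ) (u t)).trans (hmul τ).coeFn_toLp.symm)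
  have hstrong : Tendsto (fun τ => mulOp (hm τ) (u t)) (𝓝[s] t) (𝓝 (mulOp (hm t) (u t))) := by
    simp only [hmulOp]
    refine tendsto_toLp_of_dominated ENNReal.ofNat_ne_top hmul (hmul t)
      ((Lp.memLp (u t)).norm.const_mul C) (.of_forall fun τ => ae_of_all _ fun x => ?_)
      (ae_of_all _ fun x => ((hcont x).tendsto t).mono_left nhdsWithin_le_nhds |>.mul_const _)
    rw [norm_mul]
    exact mul_le_mul_of_nonneg_right (hC τ x) (norm_nonneg _)
  have hsmall : Tendsto (fun τ => mulOp (hm τ) (u τ - u t)) (𝓝[s] t) (𝓝 0) := by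
    have hu0 := (tendsto_iff_norm_sub_tendsto_zero.1 (hu t ht)).const_mul C
    rw [mul_zero] at hu0
    exact squeeze_zero_norm (fun τ => norm_mulOp_le (hm τ) (hC τ) _) hu0
  simpa only [ContinuousWithinAt, map_sub, sub_add_cancel, zero_add] using hsmall.add hstrong

end MulOp

/-! ### The Schrödinger equation in the interaction picture -/

section FreePhase

variable {E : Type*} [NormedAddCommGroup E]

/-- The frequency `2π² ε |ξ|²` with which the mode `e^{2π i ξ·x}` oscillates under the free
Schrödinger equation. -/
def freeFreq (ε : ℝ) (ξ : E) : ℝ := 2 * Real.pi ^ 2 * ε * ‖ξ‖ ^ 2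

/-- The phase by which the free Schrödinger flow is undone on the Fourier side. -/
def freePhase (ε t : ℝ) (ξ : E) : ℂ := cis (t * freeFreq ε ξ)

variable (ε : ℝ)

@[simp] lemma norm_freePhase (t : ℝ) (ξ : E) : ‖freePhase ε t ξ‖ = 1 := norm_cis _

lemma continuous_freePhase_time (ξ : E) : Continuous fun t => freePhase ε t ξ := by
  unfold freePhase
  fun_prop

lemma hasDerivAt_freePhase (t : ℝ) (ξ : E) :
    HasDerivAt (fun t => freePhase ε t ξ) (Complex.I * freeFreq ε ξ * freePhase ε t ξ) t := by
  convert! (hasDerivAt_cis (t * freeFreq ε ξ)).scomp t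
    ((hasDerivAt_id t).mul_const (freeFreq ε ξ)) using 1
  rw [one_mul, Complex.real_smul, freePhase]
  ring

variable [InnerProductSpace ℝ E]

lemma hasTemperateGrowth_freeFreq : (freeFreq ε : E → ℝ).HasTemperateGrowth := by
  unfold freeFreq
  fun_prop

lemma hasTemperateGrowth_freePhase (t : ℝ) : (freePhase ε t : E → ℂ).HasTemperateGrowth :=
  hasTemperateGrowth_cis.comp (.mul (.const t) (hasTemperateGrowth_freeFreq ε))

end FreePhase

section FreeFlow

variable {E : Type*} [NormedAddCommGroup E] [InnerProductSpace ℝ E] [FiniteDimensional ℝ E]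
  [MeasurableSpace E] [BorelSpace E]

lemma integral_fourierInv_Lp_mul (φ : Lp ℂ 2 (volume : Measure E)) (χ : SchwartzMap E ℂ) :
    ∫ ξ, (𝓕⁻ φ : Lp ℂ 2 (volume : Measure E)) ξ * χ ξ = ∫ x, φ x * 𝓕⁻ χ x := by
  have htempered := DFunLike.congr_fun (Lp.fourierInv_toTemperedDistribution_eq φ) χ
  simpa only [TemperedDistribution.fourierInv_apply, Lp.toTemperedDistribution_apply,
    smul_eq_mul, mul_comm] using htempered.symm

lemma laplacian_fourierInv (χ : SchwartzMap E ℂ) (x : E) :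
    Laplacian.laplacian (𝓕⁻ χ : SchwartzMap E ℂ) x =
      -(2 * Real.pi) ^ 2 * 𝓕⁻ (SchwartzMap.smulLeftCLM ℂ (fun ξ : E => ‖ξ‖ ^ 2) χ) x := by
  rw [SchwartzMap.laplacian_eq_fourierMultiplierCLM, SchwartzMap.fourierMultiplierCLM_apply,
    fourier_fourierInv_eq]
  simp

variable (ε : ℝ)

lemma memLp_freePhase (t : ℝ) : MemLp (freePhase ε t : E → ℂ) ⊤ volume :=
  memLp_top_of_bound (hasTemperateGrowth_freePhase ε t).1.continuous.aestronglyMeasurable 1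
    (ae_of_all _ fun ξ => (norm_freePhase ε t ξ).le)

/-- The backward free Schrödinger flow `e^{-i t ε Δ / 2}` on `L²`. -/
def backFlow (t : ℝ) : Lp ℂ 2 (volume : Measure E) →L[ℂ] Lp ℂ 2 (volume : Measure E) :=
  fourierCLM ℂ _ ∘L mulOp (memLp_freePhase ε t) ∘L fourierInvCLM ℂ _

lemma fourierInv_backFlow (t : ℝ) (φ : Lp ℂ 2 (volume : Measure E)) :
    𝓕⁻ (backFlow ε t φ) = mulOp (memLp_freePhase ε t) (𝓕⁻ φ) :=
  fourierInv_fourier_eq _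

lemma inner_fourierInv (φ ψ : Lp ℂ 2 (volume : Measure E)) :
    inner ℂ (𝓕⁻ φ) (𝓕⁻ ψ) = inner ℂ φ ψ :=
  (Lp.fourierTransformₗᵢ E ℂ).symm.inner_map_map φ ψ

lemma inner_backFlow (t : ℝ) (φ ψ : Lp ℂ 2 (volume : Measure E)) :
    inner ℂ (backFlow ε t φ) (backFlow ε t ψ) = inner ℂ φ ψ := by
  rw [← inner_fourierInv, fourierInv_backFlow, fourierInv_backFlow,
    inner_mulOp_mulOp _ (norm_freePhase ε t), inner_fourierInv]

variable {ε}

lemma hasDerivWithinAt_integral_mul_freePhase {s : Set ℝ} (hs : Convex ℝ s) {t : ℝ} (ht : t ∈ s)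
    {f : ℝ → Lp ℂ 2 (volume : Measure E)} (hf : ContinuousWithinAt f s t) (χ : SchwartzMap E ℂ)
    {D : ℂ} (hD : HasDerivWithinAt (fun τ => ∫ ξ, f τ ξ * (freePhase ε t ξ * χ ξ)) D s t) :
    HasDerivWithinAt (fun τ => ∫ ξ, f τ ξ * (freePhase ε τ ξ * χ ξ))
      (D + ∫ ξ, f t ξ * (Complex.I * freeFreq ε ξ * (freePhase ε t ξ * χ ξ))) s t := by
  set ωχ : SchwartzMap E ℂ := SchwartzMap.smulLeftCLM ℂ (freeFreq ε) χ
  have hωχ : ∀ (τ : ℝ) (ξ : E),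
      ‖Complex.I * freeFreq ε ξ * (freePhase ε τ ξ * χ ξ)‖ = ‖ωχ ξ‖ := fun τ ξ => by
    simp [ωχ, SchwartzMap.smulLeftCLM_apply_apply (hasTemperateGrowth_freeFreq ε)]
  have hphase : ∀ τ, Continuous (freePhase ε τ : E → ℂ) := fun τ =>
    (hasTemperateGrowth_freePhase ε τ).1.continuous
  have hfreq : Continuous (freeFreq ε : E → ℝ) := (hasTemperateGrowth_freeFreq ε).1.continuous
  refine hasDerivWithinAt_integral_mul
    (c' := fun τ ξ => Complex.I * freeFreq ε ξ * (freePhase ε τ ξ * χ ξ)) hs ht hf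
    (fun τ => (χ.memLp 2).mul' (memLp_freePhase ε τ)) ?_ (ωχ.memLp 2).norm
    (fun τ _ ξ => ?_) (fun τ _ ξ => (hωχ τ ξ).le) hD
  · exact (ωχ.memLp 2).congr_norm
      (by have := hphase t; fun_prop : Continuous _).aestronglyMeasurable
      (ae_of_all _ fun ξ => (hωχ t ξ).symm)
  · rw [← mul_assoc]
    exact ((hasDerivAt_freePhase ε τ ξ).mul_const (χ ξ)).hasDerivWithinAt

end FreeFlow

section Schrodinger

variable {d : ℕ} {ε T : ℝ} {V : Pos d →ᵇ ℝ}

lemma memLp_potential (V : Pos d →ᵇ ℝ) : MemLp (fun x => (V x : ℂ)) ⊤ volume :=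
  memLp_top_of_bound (by fun_prop : Continuous fun x => (V x : ℂ)).aestronglyMeasurable ‖V‖
    (ae_of_all _ fun x => by simpa using V.norm_coe_le_norm x)

/-- The generator `(i ε)⁻¹ V` of the Schrödinger equation in the interaction picture. -/
def potentialGen (ε : ℝ) (V : Pos d →ᵇ ℝ) : WaveSpace d →L[ℂ] WaveSpace d :=
  (1 / (Complex.I * ε)) • mulOp (memLp_potential V)

lemma coeFn_potentialGen (ε : ℝ) (V : Pos d →ᵇ ℝ) (φ : WaveSpace d) :
    potentialGen ε V φ =ᵐ[volume] fun x => 1 / (Complex.I * ε) * (V x * φ x) := by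
  filter_upwards [coeFn_mulOp (memLp_potential V) φ,
    Lp.coeFn_smul (1 / (Complex.I * ε) : ℂ) (mulOp (memLp_potential V) φ)] with x hmul hsmul
  rw [potentialGen, smul_apply, hsmul, Pi.smul_apply, hmul, smul_eq_mul]

lemma inner_potentialGen (ε : ℝ) (V : Pos d →ᵇ ℝ) (φ ψ : WaveSpace d) :
    inner ℂ (potentialGen ε V ψ) φ + inner ℂ ψ (potentialGen ε V φ) = 0 := by
  rw [L2.inner_def, L2.inner_def, ← integral_add (L2.integrable_inner _ _)
    (L2.integrable_inner _ _)]
  refine integral_eq_zero_of_ae ?_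
  filter_upwards [coeFn_potentialGen ε V φ, coeFn_potentialGen ε V ψ] with x hφ hψ
  simp only [hφ, hψ, RCLike.inner_apply, map_mul, map_div₀, map_one, Complex.conj_I,
    Complex.conj_ofReal, Pi.zero_apply]
  ring

lemma integral_mul_schrodinger_fourierInv (hε : ε ≠ 0) (V : Pos d →ᵇ ℝ) (φ : WaveSpace d)
    (χ : SchwartzMap (Pos d) ℂ) :
    (1 / (Complex.I * ε)) * ∫ x, φ x *
        (-((ε : ℂ) ^ 2 / 2) * Laplacian.laplacian (𝓕⁻ χ : SchwartzMap (Pos d) ℂ) x +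
          (V x : ℂ) * 𝓕⁻ χ x) =
      (∫ ξ, (𝓕⁻ (potentialGen ε V φ) : WaveSpace d) ξ * χ ξ) -
        ∫ ξ, (𝓕⁻ φ : WaveSpace d) ξ * (Complex.I * freeFreq ε ξ * χ ξ) := by
  set ωχ : SchwartzMap (Pos d) ℂ := SchwartzMap.smulLeftCLM ℂ (fun ξ => ‖ξ‖ ^ 2) χ with hωχ
  have hkinetic : ∫ ξ, (𝓕⁻ φ : WaveSpace d) ξ * (Complex.I * freeFreq ε ξ * χ ξ) =
      Complex.I * (2 * Real.pi ^ 2 * ε) * ∫ x, φ x * 𝓕⁻ ωχ x := by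
    rw [← integral_fourierInv_Lp_mul, ← integral_const_mul]
    congr 1 with ξ
    rw [hωχ, SchwartzMap.smulLeftCLM_apply_apply (by fun_prop), freeFreq, Complex.real_smul]
    push_cast
    ring
  have hpotential : ∫ ξ, (𝓕⁻ (potentialGen ε V φ) : WaveSpace d) ξ * χ ξ =
      1 / (Complex.I * ε) * ∫ x, φ x * (V x * 𝓕⁻ χ x) := by
    rw [integral_fourierInv_Lp_mul, ← integral_const_mul]
    refine integral_congr_ae ((coeFn_potentialGen ε V φ).mono fun x hx => ?_)
    simp only [hx]
    ring
  have hint : Integrable (fun x => φ x * 𝓕⁻ ωχ x) volume :=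
    (Lp.memLp φ).integrable_mul ((𝓕⁻ ωχ).memLp 2)
  have hVχ : MemLp (fun x => V x * 𝓕⁻ χ x) 2 volume :=
    ((𝓕⁻ χ : SchwartzMap (Pos d) ℂ).memLp 2).mul' (memLp_potential V)
  have hintV : Integrable (fun x => φ x * (V x * 𝓕⁻ χ x)) volume :=
    (Lp.memLp φ).integrable_mul hVχ
  have hsplit : ∫ x, φ x *
        (-((ε : ℂ) ^ 2 / 2) * Laplacian.laplacian (𝓕⁻ χ : SchwartzMap (Pos d) ℂ) x +
          (V x : ℂ) * 𝓕⁻ χ x) =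
      2 * Real.pi ^ 2 * ε ^ 2 * (∫ x, φ x * 𝓕⁻ ωχ x) + ∫ x, φ x * (V x * 𝓕⁻ χ x) := by
    rw [← integral_const_mul, ← integral_add (hint.const_mul _) hintV]
    congr 1 with x
    rw [laplacian_fourierInv]
    ring
  rw [hsplit, hkinetic, hpotential]
  have hεC : (ε : ℂ) ≠ 0 := Complex.ofReal_ne_zero.2 hε
  field_simp
  linear_combination (2 * Real.pi ^ 2 * ε ^ 2 * ∫ x, φ x * 𝓕⁻ ωχ x) * Complex.I_sq

namespace IsSchrodingerSolution

variable {φ ψ : ℝ → WaveSpace d}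

lemma hasDerivWithinAt_backFlow (hε : ε ≠ 0) (hφ : IsSchrodingerSolution ε T V φ) {t : ℝ}
    (ht : t ∈ Set.Icc 0 T) :
    HasDerivWithinAt (fun s => backFlow ε s (φ s)) (backFlow ε t (potentialGen ε V (φ t)))
      (Set.Icc 0 T) t := by
  have hcont : ∀ A : WaveSpace d →L[ℂ] WaveSpace d,
      ContinuousOn (fun s => 𝓕⁻ (A (φ s)) : ℝ → WaveSpace d) (Set.Icc 0 T) := fun A =>
    ((fourierInvCLM ℂ (WaveSpace d)).continuous.comp A.continuous).comp_continuousOn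
      hφ.continuousOn
  have hfourierInv : HasDerivWithinAt (fun s => mulOp (memLp_freePhase ε s) (𝓕⁻ (φ s)))
      (mulOp (memLp_freePhase ε t) (𝓕⁻ (potentialGen ε V (φ t)))) (Set.Icc 0 T) t := by
    refine hasDerivWithinAt_of_weak
      (r := fun s => mulOp (memLp_freePhase ε s) (𝓕⁻ (potentialGen ε V (φ s))))
      (convex_Icc 0 T) ht ?_ fun χ s hs => ?_
    · exact continuousOn_mulOp _ (fun s ξ => (norm_freePhase ε s ξ).le)
        (continuous_freePhase_time ε) (hcont _) t ht
    · set χs : SchwartzMap (Pos d) ℂ := SchwartzMap.smulLeftCLM ℂ (freePhase ε s) χ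
      have hχs : ∀ ξ, freePhase ε s ξ * χ ξ = χs ξ := fun ξ =>
        (SchwartzMap.smulLeftCLM_apply_apply (hasTemperateGrowth_freePhase ε s) χ ξ).symm
      have hweak := hφ.weak (𝓕⁻ χs) s hs
      rw [integral_mul_schrodinger_fourierInv hε] at hweak
      simp only [← integral_fourierInv_Lp_mul, ← hχs] at hweak
      simpa only [integral_mulOp_mul, ContinuousLinearMap.id_apply, sub_add_cancel] using
        hasDerivWithinAt_integral_mul_freePhase (convex_Icc 0 T) hs
          (hcont (.id ℂ _) s hs) χ hweak
  exact ((fourierCLM ℂ (WaveSpace d)).hasFDerivAt.restrictScalars ℝ).comp_hasDerivWithinAt t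
    hfourierInv

lemma inner_eq_inner_zero (hε : ε ≠ 0) (hφ : IsSchrodingerSolution ε T V φ)
    (hψ : IsSchrodingerSolution ε T V ψ) {t : ℝ} (ht : t ∈ Set.Icc 0 T) :
    inner ℂ (ψ t) (φ t) = inner ℂ (ψ 0) (φ 0) := by
  have hderiv : ∀ s ∈ Set.Icc 0 T,
      HasDerivWithinAt (fun s => inner ℂ (ψ s) (φ s)) 0 (Set.Icc 0 T) s := by
    intro s hs
    have hinner := (hψ.hasDerivWithinAt_backFlow hε hs).inner ℂ (hφ.hasDerivWithinAt_backFlow hε hs)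
    simp only [inner_backFlow] at hinner
    rwa [add_comm, inner_potentialGen] at hinner
  simpa [sub_eq_zero] using (convex_Icc 0 T).norm_image_sub_le_of_norm_hasDerivWithin_le hderiv
    (fun s _ => (norm_zero (E := ℂ)).le) (Set.left_mem_Icc.2 (ht.1.trans ht.2)) ht

end IsSchrodingerSolution

end Schrodinger

/-! ### Free transport and chords -/

section Shear

variable {E : Type*} [NormedAddCommGroup E] [NormedSpace ℝ E]

/-- The free transport map `(x, k) ↦ (x + s k, k)` on phase space. -/
def shear (s : ℝ) : (E × E) ≃L[ℝ] E × E :=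
  (ContinuousLinearEquiv.prodComm ℝ E E).trans <|
    ((ContinuousLinearEquiv.refl ℝ E).skewProd (.refl ℝ E) (s • .id ℝ E)).trans <|
      ContinuousLinearEquiv.prodComm ℝ E E

lemma shear_apply (s : ℝ) (w : E × E) : shear s w = (w.1 + s • w.2, w.2) := rfl

lemma shear_shear (s t : ℝ) (w : E × E) : shear s (shear t w) = shear (s + t) w := by
  simp only [shear_apply, add_smul]
  rw [add_right_comm, add_assoc]

lemma shear_zero (w : E × E) : shear 0 w = w := by simp [shear_apply]

variable [MeasurableSpace E] [BorelSpace E] [SecondCountableTopology E]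

lemma measurePreserving_shear (μ : Measure E) [SFinite μ] [μ.IsAddRightInvariant] (s : ℝ) :
    MeasurePreserving (shear s : E × E → E × E) (μ.prod μ) (μ.prod μ) := by
  have hskew : MeasurePreserving (fun w : E × E => (w.1, w.2 + s • w.1)) (μ.prod μ) (μ.prod μ) :=
    (MeasurePreserving.id μ).skew_product (g := fun x y => y + s • x) (by fun_prop)
      (ae_of_all _ fun x => map_add_right_eq_self _ _)
  exact (Measure.measurePreserving_swap.comp hskew).comp Measure.measurePreserving_swap

end Shear

section Chord

open Module

variable {E : Type*} [NormedAddCommGroup E] [InnerProductSpace ℝ E] {ε : ℝ}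

/-- The two endpoints `x ∓ (ε/2) y` of the chord with midpoint `x` and direction `y`. -/
def chord (ε : ℝ) (w : E × E) : E × E := (w.1 - (ε / 2) • w.2, w.1 + (ε / 2) • w.2)

lemma chord_eq_comp (ε : ℝ) : (chord ε : E × E → E × E) =
    (fun w => (w.1, w.1 + w.2)) ∘ Prod.map id (ε • ·) ∘ shear (-(ε / 2)) := by
  ext1 w
  simp only [chord, Function.comp_apply, shear_apply, Prod.map, id_eq, Prod.mk.injEq]
  constructor <;> module

/-- The product of the value of `f` at one endpoint of a chord and of the conjugate of the value
of `g` at the other. Its Fourier transform in the direction of the chord is the Wigner transform. -/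
def chordProduct (ε : ℝ) (f g : E → ℂ) (w : E × E) : ℂ := f (chord ε w).1 * conj (g (chord ε w).2)

variable [FiniteDimensional ℝ E] [MeasurableSpace E] [BorelSpace E]

@[fun_prop] lemma measurable_chord (ε : ℝ) : Measurable (chord ε : E × E → E × E) := by
  unfold chord
  fun_prop

lemma map_chord (hε : 0 < ε) : Measure.map (chord ε) (volume : Measure (E × E)) =
    ENNReal.ofReal (ε ^ finrank ℝ E)⁻¹ • volume := by
  have hscale : Measure.map (Prod.map id (ε • ·)) (volume : Measure (E × E)) =
      ENNReal.ofReal (ε ^ finrank ℝ E)⁻¹ • volume := by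
    rw [Measure.volume_eq_prod, ← Measure.map_prod_map _ _ measurable_id (by fun_prop),
      Measure.map_id, Measure.map_addHaar_smul _ hε.ne', abs_of_pos (by positivity),
      Measure.prod_smul_right]
  rw [chord_eq_comp, ← Measure.map_map (by fun_prop) (by fun_prop),
    ← Measure.map_map (by fun_prop) (by fun_prop), Measure.volume_eq_prod,
    (measurePreserving_shear volume _).map_eq, ← Measure.volume_eq_prod, hscale, Measure.map_smul,
    Measure.volume_eq_prod, (measurePreserving_prod_add volume volume).map_eq]

lemma integral_comp_chord (hε : 0 < ε) {F : E × E → ℂ} (hF : AEStronglyMeasurable F volume) :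
    ∫ w, F (chord ε w) = ((ε : ℂ) ^ finrank ℝ E)⁻¹ * ∫ w, F w := by
  rw [← integral_map (measurable_chord ε).aemeasurable (by
      rw [map_chord hε]
      exact hF.smul_measure _), map_chord hε, integral_smul_measure,
    ENNReal.toReal_ofReal (by positivity), Complex.real_smul]
  push_cast
  rfl

lemma lintegral_comp_chord (hε : 0 < ε) {F : E × E → ℝ≥0∞} (hF : Measurable F) :
    ∫⁻ w, F (chord ε w) = ENNReal.ofReal (ε ^ finrank ℝ E)⁻¹ * ∫⁻ w, F w := by
  rw [← lintegral_map hF (measurable_chord ε), map_chord hε, lintegral_smul_measure, smul_eq_mul]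

variable {f g : E → ℂ}

lemma stronglyMeasurable_chordProduct (hf : StronglyMeasurable f) (hg : StronglyMeasurable g)
    (ε : ℝ) : StronglyMeasurable (chordProduct ε f g) :=
  (hf.comp_measurable (measurable_chord ε).fst).mul
    (Complex.continuous_conj.comp_stronglyMeasurable
      (hg.comp_measurable (measurable_chord ε).snd))

lemma integrable_chordProduct (hε : ε ≠ 0) (hf : MemLp f 2) (hg : MemLp g 2) (x : E) :
    Integrable fun y => chordProduct ε f g (x, y) := by
  have htranslate : ∀ {h : E → ℂ}, MemLp h 2 → MemLp (fun y => h (x + y)) 2 := fun hh =>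
    hh.comp_measurePreserving (measurePreserving_add_left volume x)
  have hleft := memLp_comp_smul (r := -(ε / 2)) (by simpa using hε) (htranslate hf)
  have hright := memLp_comp_smul (r := ε / 2) (by simpa using hε) (htranslate hg)
  refine (hleft.integrable_mul hright.star).congr (ae_of_all _ fun y => ?_)
  simp [chordProduct, chord, sub_eq_add_neg]

lemma lintegral_enorm_chordProduct_sq (hε : 0 < ε) (hf : StronglyMeasurable f)
    (hg : StronglyMeasurable g) :
    ∫⁻ w, ‖chordProduct ε f g w‖ₑ ^ 2 = ENNReal.ofReal (ε ^ finrank ℝ E)⁻¹ *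
      ((∫⁻ u, ‖f u‖ₑ ^ 2) * ∫⁻ v, ‖g v‖ₑ ^ 2) := by
  have hfm : Measurable fun u => ‖f u‖ₑ ^ 2 := hf.measurable.enorm.pow_const 2
  have hgm : Measurable fun v => ‖g v‖ₑ ^ 2 := hg.measurable.enorm.pow_const 2
  rw [← lintegral_prod_mul hfm.aemeasurable hgm.aemeasurable, ← Measure.volume_eq_prod,
    ← lintegral_comp_chord hε (by fun_prop)]
  simp only [chordProduct, enorm_mul, mul_pow, RCLike.enorm_conj]

lemma ae_memLp_chordProduct (hε : 0 < ε) (hf : StronglyMeasurable f) (hg : StronglyMeasurable g)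
    (hf2 : MemLp f 2) (hg2 : MemLp g 2) :
    ∀ᵐ x : E, MemLp (fun y => chordProduct ε f g (x, y)) 2 := by
  have hmeas := stronglyMeasurable_chordProduct hf hg ε
  have hsq : Measurable fun w => ‖chordProduct ε f g w‖ₑ ^ 2 := hmeas.measurable.enorm.pow_const 2
  have hfinite : ∫⁻ x, ∫⁻ y, ‖chordProduct ε f g (x, y)‖ₑ ^ 2 ≠ ⊤ := by
    rw [← lintegral_prod _ hsq.aemeasurable, ← Measure.volume_eq_prod,
      lintegral_enorm_chordProduct_sq hε hf hg]
    exact ENNReal.mul_ne_top ENNReal.ofReal_ne_top (ENNReal.mul_ne_top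
      ((memLp_two_iff_lintegral_lt_top hf2.1).1 hf2).ne
      ((memLp_two_iff_lintegral_lt_top hg2.1).1 hg2).ne)
  filter_upwards [ae_lt_top hsq.lintegral_prod_right' hfinite] with x hx
  exact (memLp_two_iff_lintegral_lt_top
    (hmeas.comp_measurable measurable_prodMk_left).aestronglyMeasurable).2 hx

end Chord

/-! ### The Wigner transform on `L²` -/

section FibrewiseFourier

open Module

variable {X E : Type*} [MeasurableSpace X] [NormedAddCommGroup E] [InnerProductSpace ℝ E]
  [FiniteDimensional ℝ E] [MeasurableSpace E] [BorelSpace E] {F : X × E → ℂ}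

lemma stronglyMeasurable_oscIntegral_snd (hF : StronglyMeasurable F) :
    StronglyMeasurable fun w : X × E => oscIntegral (fun y => F (w.1, y)) w.2 := by
  have hphase : StronglyMeasurable fun q : (X × E) × E => cis (inner ℝ q.1.2 q.2) :=
    (continuous_cis.comp continuous_inner).stronglyMeasurable.comp_measurable
      (by fun_prop : Measurable fun q : (X × E) × E => (q.1.2, q.2))
  exact (hphase.mul (hF.comp_measurable (by fun_prop :
    Measurable fun q : (X × E) × E => (q.1.1, q.2)))).integral_prod_right'

lemma lintegral_oscIntegral_snd {μ : Measure X} [SFinite μ] (hF : StronglyMeasurable F)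
    (hint : ∀ᵐ x ∂μ, Integrable fun y => F (x, y))
    (hmem : ∀ᵐ x ∂μ, MemLp (fun y => F (x, y)) 2) :
    ∫⁻ w, ‖oscIntegral (fun y => F (w.1, y)) w.2‖ₑ ^ 2 ∂μ.prod volume =
      ENNReal.ofReal ((2 * Real.pi) ^ finrank ℝ E) * ∫⁻ w, ‖F w‖ₑ ^ 2 ∂μ.prod volume := by
  rw [lintegral_prod _
      ((stronglyMeasurable_oscIntegral_snd hF).measurable.enorm.pow_const 2).aemeasurable,
    lintegral_prod _ (hF.measurable.enorm.pow_const 2).aemeasurable,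
    ← lintegral_const_mul' _ _ ENNReal.ofReal_ne_top]
  refine lintegral_congr_ae ?_
  filter_upwards [hint, hmem] with x hintx hmemx
  exact lintegral_enorm_sq_oscIntegral hintx hmemx

end FibrewiseFourier

section WignerTransform

variable {d : ℕ} {ε : ℝ}

lemma wignerTransform_eq_oscIntegral (ε : ℝ) (φ₁ φ₂ : WaveSpace d) (w : Phase d) :
    wignerTransform ε φ₁ φ₂ w =
      (1 / (2 * Real.pi : ℂ) ^ d) * oscIntegral (fun y => chordProduct ε φ₁ φ₂ (w.1, y)) w.2 := by
  simp only [wignerTransform, oscIntegral, chordProduct, chord, mul_assoc]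

lemma stronglyMeasurable_wignerTransform (ε : ℝ) (φ₁ φ₂ : WaveSpace d) :
    StronglyMeasurable (wignerTransform ε φ₁ φ₂) := by
  rw [funext (wignerTransform_eq_oscIntegral ε φ₁ φ₂)]
  exact (stronglyMeasurable_oscIntegral_snd (stronglyMeasurable_chordProduct
    (Lp.stronglyMeasurable φ₁) (Lp.stronglyMeasurable φ₂) ε)).const_mul _

lemma lintegral_wignerTransform (hε : 0 < ε) (φ₁ φ₂ : WaveSpace d) :
    ∫⁻ w, ‖wignerTransform ε φ₁ φ₂ w‖ₑ ^ 2 =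
      ENNReal.ofReal ((2 * Real.pi * ε) ^ d)⁻¹ * (‖φ₁‖ₑ ^ 2 * ‖φ₂‖ₑ ^ 2) := by
  have hconst : ‖1 / (2 * Real.pi : ℂ) ^ d‖ₑ ^ 2 *
      (ENNReal.ofReal ((2 * Real.pi) ^ d) * ENNReal.ofReal (ε ^ d)⁻¹) =
        ENNReal.ofReal ((2 * Real.pi * ε) ^ d)⁻¹ := by
    rw [← ofReal_norm, ← ENNReal.ofReal_pow (by positivity),
      ← ENNReal.ofReal_mul (by positivity), ← ENNReal.ofReal_mul (by positivity)]
    congr 1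
    simp only [norm_div, norm_one, norm_pow, norm_mul, Complex.norm_ofNat, Complex.norm_real,
      Real.norm_of_nonneg Real.pi_pos.le]
    rw [mul_pow _ ε]
    field_simp
  have hsq : ∀ w, ‖wignerTransform ε φ₁ φ₂ w‖ₑ ^ 2 = ‖1 / (2 * Real.pi : ℂ) ^ d‖ₑ ^ 2 *
      ‖oscIntegral (fun y => chordProduct ε φ₁ φ₂ (w.1, y)) w.2‖ₑ ^ 2 := fun w => by
    rw [wignerTransform_eq_oscIntegral, enorm_mul, mul_pow]
  rw [lintegral_congr hsq, lintegral_const_mul' _ _ (by finiteness), Measure.volume_eq_prod,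
    lintegral_oscIntegral_snd (stronglyMeasurable_chordProduct (Lp.stronglyMeasurable φ₁)
      (Lp.stronglyMeasurable φ₂) ε)
      (ae_of_all _ (integrable_chordProduct hε.ne' (Lp.memLp φ₁) (Lp.memLp φ₂)))
      (ae_memLp_chordProduct hε (Lp.stronglyMeasurable φ₁) (Lp.stronglyMeasurable φ₂)
        (Lp.memLp φ₁) (Lp.memLp φ₂)),
    ← Measure.volume_eq_prod, lintegral_enorm_chordProduct_sq hε (Lp.stronglyMeasurable φ₁)
      (Lp.stronglyMeasurable φ₂), lintegral_enorm_sq, lintegral_enorm_sq,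
    finrank_euclideanSpace_fin, ← hconst, Lp.enorm_def, Lp.enorm_def]
  ring

lemma memLp_wignerTransform (hε : 0 < ε) (φ₁ φ₂ : WaveSpace d) :
    MemLp (wignerTransform ε φ₁ φ₂) 2 := by
  rw [memLp_two_iff_lintegral_lt_top
    (stronglyMeasurable_wignerTransform ε φ₁ φ₂).aestronglyMeasurable,
    lintegral_wignerTransform hε]
  finiteness

lemma norm_toLp_wignerTransform (hε : 0 < ε) (φ₁ φ₂ : WaveSpace d) :
    ‖(memLp_wignerTransform hε φ₁ φ₂).toLp‖ =
      Real.sqrt ((2 * Real.pi * ε) ^ d)⁻¹ * ‖φ₁‖ * ‖φ₂‖ := by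
  have hsq := congrArg ENNReal.toReal (lintegral_wignerTransform hε φ₁ φ₂)
  rw [lintegral_enorm_sq, ENNReal.toReal_pow, ENNReal.toReal_mul, ENNReal.toReal_mul,
    ENNReal.toReal_pow, ENNReal.toReal_pow, toReal_enorm, toReal_enorm,
    ENNReal.toReal_ofReal (by positivity), ← Lp.norm_toLp _ (memLp_wignerTransform hε φ₁ φ₂)] at hsq
  rw [← sq_eq_sq₀ (norm_nonneg _) (by positivity), hsq, mul_pow _ ‖φ₂‖,
    mul_pow _ ‖φ₁‖, Real.sq_sqrt (by positivity)]
  ring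

end WignerTransform

/-! ### Parity operators -/

section Parity

variable {E : Type*} [NormedAddCommGroup E] [InnerProductSpace ℝ E]

lemma freePhase_sub_mul_conj (ε t : ℝ) (b ξ : E) :
    freePhase ε t (-((2 * Real.pi)⁻¹ • b) - ξ) * conj (freePhase ε t ξ) =
      cis (t * ε / 2 * ‖b‖ ^ 2) * cis (inner ℝ ((2 * Real.pi) • (t * ε) • b) ξ) := by
  rw [freePhase, freePhase, conj_cis, ← cis_add, ← cis_add, freeFreq, freeFreq, norm_sub_sq_real]
  congr 1
  simp only [norm_neg, norm_smul, inner_neg_left, real_inner_smul_left, mul_pow, norm_inv, norm_mul,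
    Real.norm_ofNat, Real.norm_of_nonneg Real.pi_pos.le]
  field_simp
  ring

variable [FiniteDimensional ℝ E] [MeasurableSpace E] [BorelSpace E]

lemma memLp_cis_inner (b : E) : MemLp (fun u => cis (inner ℝ b u)) ⊤ volume :=
  memLp_top_of_bound (by fun_prop : Continuous _).aestronglyMeasurable 1
    (ae_of_all _ fun _ => (norm_cis _).le)

/-- The reflection and modulation `φ ↦ (u ↦ e^{i b·u} φ(a - u))` on `L²`. Up to a factor, the
Wigner transform of `φ₁` and `φ₂` is a matrix element of such an operator. -/
def parityOp (a b : E) : Lp ℂ 2 (volume : Measure E) →L[ℂ] Lp ℂ 2 (volume : Measure E) :=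
  mulOp (memLp_cis_inner b) ∘L (Lp.compMeasurePreservingₗᵢ ℂ (a - ·)
    (Measure.measurePreserving_sub_left volume a)).toContinuousLinearMap

lemma coeFn_parityOp (a b : E) (φ : Lp ℂ 2 (volume : Measure E)) :
    parityOp a b φ =ᵐ[volume] fun u => cis (inner ℝ b u) * φ (a - u) := by
  have hreflect := Measure.measurePreserving_sub_left (volume : Measure E) a
  filter_upwards [coeFn_mulOp (memLp_cis_inner b) (Lp.compMeasurePreserving _ hreflect φ),
    Lp.coeFn_compMeasurePreserving φ hreflect] with u hmul hcomp
  exact hmul.trans (congrArg _ hcomp)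

lemma parityOp_toLp {f : E → ℂ} (hf : MemLp f 2) {a b : E}
    (hg : MemLp (fun u => cis (inner ℝ b u) * f (a - u)) 2) :
    parityOp a b hf.toLp = hg.toLp := by
  refine Lp.ext ?_
  filter_upwards [coeFn_parityOp a b hf.toLp, hg.coeFn_toLp,
    (Measure.measurePreserving_sub_left volume a).quasiMeasurePreserving.ae hf.coeFn_toLp]
    with u hparity htoLp hu
  rw [hparity, htoLp, hu]

lemma oscIntegral_cis_mul_comp_sub (a b : E) (f : E → ℂ) (k : E) :
    oscIntegral (fun u => cis (inner ℝ b u) * f (a - u)) k =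
      cis (inner ℝ (k + b) a) * oscIntegral f (-(k + b)) := by
  rw [oscIntegral, oscIntegral, ← integral_sub_left_eq_self _ _ a, ← integral_const_mul]
  congr 1 with u
  rw [sub_sub_cancel, ← mul_assoc, ← mul_assoc, ← cis_add, ← cis_add]
  congr 2
  simp only [inner_add_left, inner_sub_right, inner_neg_left]
  ring

lemma fourierInv_parityOp (a b : E) (φ : Lp ℂ 2 (volume : Measure E)) :
    𝓕⁻ (parityOp a b φ) = cis (inner ℝ b a) •
      parityOp (-((2 * Real.pi)⁻¹ • b)) ((2 * Real.pi) • a) (𝓕⁻ φ) := by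
  refine (SchwartzMap.denseRange_toLpCLM (F := ℂ) (p := 2) (μ := (volume : Measure E))
    ENNReal.ofNat_ne_top).induction_on φ ?_ fun χ => ?_
  · exact isClosed_eq ((fourierInvCLM ℂ _).continuous.comp (parityOp a b).continuous)
      (((parityOp _ _).continuous.comp
        (fourierInvCLM ℂ (Lp ℂ 2 (volume : Measure E))).continuous).const_smul
          (cis (inner ℝ b a)))
  have hreflect := Measure.measurePreserving_sub_left (volume : Measure E) a
  have hint : Integrable fun u => cis (inner ℝ b u) * χ (a - u) :=
    (χ.integrable.comp_sub_left a).bdd_mul (c := 1)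
      (by fun_prop : Continuous fun u => cis (inner ℝ b u)).aestronglyMeasurable
      (ae_of_all _ fun _ => (norm_cis _).le)
  have hmem : MemLp (fun u => cis (inner ℝ b u) * χ (a - u)) 2 :=
    ((χ.memLp 2).comp_measurePreserving hreflect).mul' (memLp_cis_inner b)
  have hparity : parityOp a b (χ.toLp 2) = hmem.toLp := parityOp_toLp (χ.memLp 2) hmem
  set a' : E := -((2 * Real.pi)⁻¹ • b) with ha'
  have hcentre : ∀ ξ, -((2 * Real.pi) • ξ + b) = (2 * Real.pi) • (a' - ξ) := fun ξ => by
    rw [ha', smul_sub, smul_neg, smul_inv_smul₀ (by positivity)]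
    abel
  rw [SchwartzMap.toLpCLM_apply, hparity, SchwartzMap.toLp_fourierInv_eq]
  refine Lp.ext ?_
  filter_upwards [coeFn_fourierInv_toLp hint hmem,
    Lp.coeFn_smul (cis (inner ℝ b a)) (parityOp a' ((2 * Real.pi) • a) ((𝓕⁻ χ).toLp 2)),
    coeFn_parityOp a' ((2 * Real.pi) • a) ((𝓕⁻ χ).toLp 2),
    (Measure.measurePreserving_sub_left volume a').quasiMeasurePreserving.ae
      ((𝓕⁻ χ).coeFn_toLp 2 volume)] with ξ hfourier hsmul hparity' hχ
  rw [hfourier, hsmul, Pi.smul_apply, hparity', hχ, SchwartzMap.fourierInv_coe,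
    fourierInv_eq_oscIntegral, fourierInv_eq_oscIntegral, oscIntegral_cis_mul_comp_sub, hcentre,
    smul_eq_mul, ← mul_assoc, ← cis_add, inner_add_left, inner_smul_left, inner_smul_left,
    real_inner_comm, add_comm]

lemma inner_backFlow_parityOp (ε t : ℝ) (a b : E) (φ₁ φ₂ : Lp ℂ 2 (volume : Measure E)) :
    inner ℂ (backFlow ε t φ₂) (parityOp a b (backFlow ε t φ₁)) =
      cis (-(t * ε / 2 * ‖b‖ ^ 2)) * inner ℂ φ₂ (parityOp (a + (t * ε) • b) b φ₁) := by
  rw [← inner_fourierInv, fourierInv_parityOp, ← inner_fourierInv φ₂, fourierInv_parityOp,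
    fourierInv_backFlow, fourierInv_backFlow, inner_smul_right, inner_smul_right, ← mul_assoc,
    ← cis_add]
  set a' : E := -((2 * Real.pi)⁻¹ • b)
  rw [L2.inner_def, L2.inner_def, ← integral_const_mul, ← integral_const_mul]
  refine integral_congr_ae ?_
  filter_upwards [coeFn_mulOp (memLp_freePhase ε t) (𝓕⁻ φ₂),
    coeFn_parityOp a' ((2 * Real.pi) • a) (mulOp (memLp_freePhase ε t) (𝓕⁻ φ₁)),
    coeFn_parityOp a' ((2 * Real.pi) • (a + (t * ε) • b)) (𝓕⁻ φ₁),
    (Measure.measurePreserving_sub_left volume a').quasiMeasurePreserving.ae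
      (coeFn_mulOp (memLp_freePhase ε t) (𝓕⁻ φ₁))] with ξ hφ₂ hleft hright hφ₁
  have hconst : cis (-(t * ε / 2 * ‖b‖ ^ 2) + inner ℝ b (a + (t * ε) • b)) =
      cis (inner ℝ b a) * cis (t * ε / 2 * ‖b‖ ^ 2) := by
    rw [← cis_add, inner_add_right, inner_smul_right, real_inner_self_eq_norm_sq]
    congr 1
    ring
  rw [hφ₂, hleft, hright, hφ₁, hconst, smul_add, inner_add_left, cis_add]
  simp only [RCLike.inner_apply, map_mul]
  linear_combination (cis (inner ℝ b a) * cis (inner ℝ ((2 * Real.pi) • a) ξ) *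
    (𝓕⁻ φ₁ : Lp ℂ 2 (volume : Measure E)) (a' - ξ) *
    conj ((𝓕⁻ φ₂ : Lp ℂ 2 (volume : Measure E)) ξ)) * freePhase_sub_mul_conj ε t b ξ

end Parity

section WignerL2

variable {d : ℕ} {ε : ℝ}

lemma wignerTransform_eq_inner (hε : 0 < ε) (φ₁ φ₂ : WaveSpace d) (w : Phase d) :
    wignerTransform ε φ₁ φ₂ w = (1 / (2 * Real.pi : ℂ) ^ d) * ((((ε / 2 : ℝ) : ℂ) ^ d)⁻¹ *
      (cis (-inner ℝ ((2 / ε) • w.2) w.1) *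
        inner ℂ φ₂ (parityOp ((2 : ℝ) • w.1) ((2 / ε) • w.2) φ₁))) := by
  obtain ⟨x, k⟩ := w
  set F : Pos d → ℂ := fun v => cis (inner ℝ ((2 / ε) • k) v) * φ₁ (x - v) * conj (φ₂ (x + v))
    with hF
  have hphase : ∀ y : Pos d, inner ℝ k y = inner ℝ ((2 / ε) • k) ((ε / 2) • y) := fun y => by
    rw [real_inner_smul_left, real_inner_smul_right]
    field_simp
  have hscale : ∫ y, F ((ε / 2) • y) = (((ε / 2 : ℝ) : ℂ) ^ d)⁻¹ * ∫ v, F v := by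
    rw [Measure.integral_comp_smul_of_nonneg _ _ _ (hR := by positivity),
      finrank_euclideanSpace_fin, Complex.real_smul]
    push_cast
    rfl
  have htranslate : ∫ v, F v = cis (-inner ℝ ((2 / ε) • k) x) *
      inner ℂ φ₂ (parityOp ((2 : ℝ) • x) ((2 / ε) • k) φ₁) := by
    rw [L2.inner_def, ← integral_const_mul, ← integral_sub_right_eq_self F x]
    refine integral_congr_ae ?_
    filter_upwards [coeFn_parityOp ((2 : ℝ) • x) ((2 / ε) • k) φ₁] with u hu
    simp only [hF]
    rw [hu, add_sub_cancel, show x - (u - x) = (2 : ℝ) • x - u by module, inner_sub_right,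
      sub_eq_add_neg, cis_add, RCLike.inner_apply]
    ring
  rw [← htranslate, ← hscale]
  simp only [wignerTransform, hphase, hF]

/-- The free Schrödinger propagator is metaplectic: its conjugation of a parity operator moves the
centre of the reflection along the classical flow. -/
lemma wignerTransform_backFlow (hε : 0 < ε) (t : ℝ) (φ₁ φ₂ : WaveSpace d) (w : Phase d) :
    wignerTransform ε (backFlow ε t φ₁) (backFlow ε t φ₂) w =
      wignerTransform ε φ₁ φ₂ (shear t w) := by
  have hcentre : (2 : ℝ) • w.1 + (t * ε) • (2 / ε) • w.2 = (2 : ℝ) • (w.1 + t • w.2) := by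
    rw [smul_smul, smul_add, smul_smul]
    congr 2
    field_simp
  rw [wignerTransform_eq_inner hε, wignerTransform_eq_inner hε, inner_backFlow_parityOp,
    shear_apply, hcentre, ← mul_assoc (cis _), ← cis_add]
  congr 4
  simp only [norm_smul, real_inner_smul_left, inner_add_right, real_inner_smul_right,
    real_inner_self_eq_norm_sq, mul_pow, Real.norm_eq_abs, sq_abs]
  field_simp
  ring

/-- The Wigner transform as a bounded map into `L²(ℝ^{2d})`. It is bilinear over `ℝ` only, being
conjugate linear in the second argument. -/
def wignerL2 (hε : 0 < ε) : WaveSpace d →L[ℝ] WaveSpace d →L[ℝ] PhaseSpaceL2 d :=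
  LinearMap.mkContinuous₂ (LinearMap.mk₂ ℝ
    (fun φ₁ φ₂ => (memLp_wignerTransform hε φ₁ φ₂).toLp)
    (fun φ₁ φ₁' φ₂ => by
      rw [← MemLp.toLp_add]
      congr 1 with w
      simp only [Pi.add_apply, wignerTransform_eq_inner hε, map_add, inner_add_right]
      ring)
    (fun c φ₁ φ₂ => by
      rw [← MemLp.toLp_const_smul]
      congr 1 with w
      simp only [Pi.smul_apply, wignerTransform_eq_inner hε, ContinuousLinearMap.map_smul_of_tower,
        inner_smul_right_eq_smul, Complex.real_smul]
      ring)
    (fun φ₁ φ₂ φ₂' => by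
      rw [← MemLp.toLp_add]
      congr 1 with w
      simp only [Pi.add_apply, wignerTransform_eq_inner hε, inner_add_left]
      ring)
    (fun c φ₁ φ₂ => by
      rw [← MemLp.toLp_const_smul]
      congr 1 with w
      simp only [Pi.smul_apply, wignerTransform_eq_inner hε, inner_smul_left_eq_smul,
        Complex.real_smul]
      ring))
    (Real.sqrt ((2 * Real.pi * ε) ^ d)⁻¹)
    (fun φ₁ φ₂ => (norm_toLp_wignerTransform hε φ₁ φ₂).le)

lemma coeFn_wignerL2 (hε : 0 < ε) (φ₁ φ₂ : WaveSpace d) :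
    wignerL2 hε φ₁ φ₂ =ᵐ[volume] wignerTransform ε φ₁ φ₂ :=
  (memLp_wignerTransform hε φ₁ φ₂).coeFn_toLp

end WignerL2

/-! ### Test functions under free transport -/

section ShearSchwartz

open Module

variable {E : Type*} [NormedAddCommGroup E]

section NormedSpace

variable [NormedSpace ℝ E]

lemma norm_le_mul_norm_shear (s : ℝ) (w : E × E) : ‖w‖ ≤ (1 + |s|) * ‖shear s w‖ := by
  set v := shear s w with hv
  have hw : w = (v.1 - s • v.2, v.2) := by simp [hv, shear_apply]
  rw [hw, Prod.norm_def]
  refine max_le ((norm_sub_le _ _).trans ?_) ((norm_snd_le v).trans ?_)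
  · rw [norm_smul, Real.norm_eq_abs, add_mul, one_mul]
    gcongr
    exacts [norm_fst_le v, norm_snd_le v]
  · exact le_mul_of_one_le_left (norm_nonneg v) (by simp)

/-- The Schwartz function `χ ∘ shear s`. -/
def shearComp (s : ℝ) (χ : SchwartzMap (E × E) ℂ) : SchwartzMap (E × E) ℂ :=
  SchwartzMap.compCLMOfContinuousLinearEquiv ℂ (shear s) χ

lemma shearComp_apply (s : ℝ) (χ : SchwartzMap (E × E) ℂ) (w : E × E) :
    shearComp s χ w = χ (shear s w) := rfl

end NormedSpace

lemma memLp_two_one_add_norm_rpow_neg [NormedSpace ℝ E] [FiniteDimensional ℝ E]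
    [MeasurableSpace E] [BorelSpace E] (μ : Measure E) [μ.IsAddHaarMeasure] {r : ℝ}
    (hr : (finrank ℝ E : ℝ) < 2 * r) : MemLp (fun x => (1 + ‖x‖) ^ (-r)) 2 μ := by
  have hcont : Continuous fun x : E => (1 + ‖x‖) ^ (-r) :=
    (by fun_prop : Continuous fun x : E => 1 + ‖x‖).rpow_const
      fun x => .inl (by positivity)
  rw [memLp_two_iff_integrable_sq hcont.aestronglyMeasurable]
  refine (integrable_one_add_norm (μ := μ) hr).congr (ae_of_all _ fun x => ?_)
  simp only
  rw [← Real.rpow_natCast, ← Real.rpow_mul (by positivity)]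
  congr 1
  push_cast
  ring

variable [InnerProductSpace ℝ E] [FiniteDimensional ℝ E] [MeasurableSpace E] [BorelSpace E]

instance : (volume : Measure (E × E)).IsAddHaarMeasure :=
  inferInstanceAs (Measure.IsAddHaarMeasure ((volume : Measure E).prod (volume : Measure E)))

lemma integral_comp_shear (s : ℝ) (f : E × E → ℂ) : ∫ w, f (shear s w) = ∫ w, f w :=
  (measurePreserving_shear volume s).integral_comp (shear s).toHomeomorph.measurableEmbedding f

lemma norm_toLp_shearComp (s : ℝ) (χ : SchwartzMap (E × E) ℂ) :
    ‖(shearComp s χ).toLp 2‖ = ‖χ.toLp 2‖ := by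
  rw [SchwartzMap.norm_toLp, SchwartzMap.norm_toLp]
  exact congrArg ENNReal.toReal (eLpNorm_comp_measurePreserving
    χ.continuous.aestronglyMeasurable (measurePreserving_shear volume s))

lemma exists_memLp_bound_comp_shear (χ : SchwartzMap (E × E) ℂ) (T : ℝ) :
    ∃ G : E × E → ℝ, MemLp G 2 ∧ ∀ s, |s| ≤ T → ∀ w, ‖χ (shear s w)‖ ≤ G w := by
  set N := finrank ℝ (E × E) + 1 with hN
  obtain ⟨C, hC⟩ : ∃ C : ℝ, ∀ w, (1 + ‖w‖) ^ N * ‖χ w‖ ≤ C := ⟨_, fun w => by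
    simpa using SchwartzMap.one_add_le_sup_seminorm_apply (𝕜 := ℝ) (m := (N, 0)) le_rfl le_rfl χ w⟩
  refine ⟨_, (memLp_two_one_add_norm_rpow_neg volume (r := N)
    (by rw [hN]; push_cast; linarith)).const_mul ((1 + T) ^ N * C), fun s hs w => ?_⟩
  have hT : 0 ≤ T := (abs_nonneg s).trans hs
  have hshear : 1 + ‖w‖ ≤ (1 + T) * (1 + ‖shear s w‖) := by
    have hnorm : ‖w‖ ≤ (1 + T) * ‖shear s w‖ := (norm_le_mul_norm_shear s w).trans (by gcongr)
    linarith
  rw [Real.rpow_neg (by positivity), Real.rpow_natCast, ← div_eq_mul_inv,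
    le_div_iff₀ (by positivity)]
  calc ‖χ (shear s w)‖ * (1 + ‖w‖) ^ N
      ≤ ‖χ (shear s w)‖ * ((1 + T) * (1 + ‖shear s w‖)) ^ N := by gcongr
    _ = (1 + T) ^ N * ((1 + ‖shear s w‖) ^ N * ‖χ (shear s w)‖) := by
        rw [mul_pow]
        ring
    _ ≤ (1 + T) ^ N * C := by gcongr; exact hC _

end ShearSchwartz

section Transport

variable {d : ℕ} (χ : SchwartzMap (Phase d) ℂ)

/-- The transport derivative `k · ∇ₓ χ` as a Schwartz function. -/
def transportS : SchwartzMap (Phase d) ℂ :=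
  SchwartzMap.bilinLeftCLM (𝕜 := ℝ) (.id ℝ (Phase d →L[ℝ] ℂ))
    (g := (ContinuousLinearMap.inl ℝ (Pos d) (Pos d)).comp (.snd ℝ _ _))
    (ContinuousLinearMap.hasTemperateGrowth _) (SchwartzMap.fderivCLM ℝ (Phase d) ℂ χ)

lemma memLp_transport : MemLp (transport χ) 2 := (transportS χ).memLp 2 volume

lemma transport_shearComp (s : ℝ) (w : Phase d) :
    transport (shearComp s χ) w = transport χ (shear s w) := by
  have hcomp := (χ.differentiableAt (x := shear s w)).hasFDerivAt.comp w
    (shear (E := Pos d) s).hasFDerivAt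
  rw [transport, transport, show ⇑(shearComp s χ) = χ ∘ shear s from rfl, hcomp.fderiv]
  simp [shear_apply]

lemma hasDerivAt_comp_shear (w : Phase d) (s : ℝ) :
    HasDerivAt (fun s => χ (shear s w)) (transport χ (shear s w)) s := by
  have hline : HasDerivAt (fun s : ℝ => w.1 + s • w.2) w.2 s := by
    simpa using ((hasDerivAt_id s).smul_const w.2).const_add w.1
  exact (χ.differentiableAt (x := shear s w)).hasFDerivAt.comp_hasDerivAt s
    (hline.prodMk (hasDerivAt_const s w.2))

lemma exists_memLp_bound_transport_comp_shear (T : ℝ) :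
    ∃ G : Phase d → ℝ, MemLp G 2 ∧ ∀ s, |s| ≤ T → ∀ w, ‖transport χ (shear s w)‖ ≤ G w :=
  exists_memLp_bound_comp_shear (transportS χ) T

end Transport

/-! ### The Wigner potential operator -/

section Fibre

variable {X E : Type*} [NormedAddCommGroup X] [NormedSpace ℝ X] [NormedAddCommGroup E]
  [NormedSpace ℝ E]

/-- The restriction `p ↦ χ (x, p)` of a Schwartz function to the fibre over `x`. -/
def fibre (χ : SchwartzMap (X × E) ℂ) (x : X) : SchwartzMap E ℂ :=
  SchwartzMap.compCLM ℂ (g := fun p => (x, p))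
    (by
      convert (Function.HasTemperateGrowth.const (x, (0 : E))).add
        (ContinuousLinearMap.inr ℝ X E).hasTemperateGrowth using 1
      ext1 p
      simp)
    ⟨1, 1, fun p => by simpa using (norm_snd_le (x, p)).trans (le_add_of_nonneg_left zero_le_one)⟩ χ

lemma fibre_apply (χ : SchwartzMap (X × E) ℂ) (x : X) (p : E) : fibre χ x p = χ (x, p) := rfl

end Fibre

section Multiplier

open Module

variable {E : Type*} [NormedAddCommGroup E] [InnerProductSpace ℝ E] [FiniteDimensional ℝ E]
  [MeasurableSpace E] [BorelSpace E]

lemma integral_oscIntegral_mul_oscIntegral_multiplier {m f : E → ℂ} (hm : MemLp m ⊤)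
    (hodd : ∀ y, m (-y) = -m y) (hf : Integrable f) (hf2 : MemLp f 2) (χ : SchwartzMap E ℂ) :
    ∫ k, oscIntegral f k * oscIntegral (fun y => m y * oscIntegral χ (-y)) k =
      -((2 * Real.pi : ℂ) ^ finrank ℝ E * ∫ k, oscIntegral (fun y => m y * f y) k * χ k) := by
  have hmf : Integrable fun y => m y * f y := hf.mul_of_top_right hm
  have hmχ : Integrable fun y => m y * oscIntegral χ (-y) :=
    (integrable_oscIntegral_neg χ).mul_of_top_right hm
  have hmχ2 : MemLp (fun y => m y * oscIntegral χ (-y)) 2 :=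
    ((memLp_oscIntegral χ.integrable (χ.memLp 2)).comp_measurePreserving
      (Measure.measurePreserving_neg volume)).mul' hm
  rw [integral_oscIntegral_mul_oscIntegral hf hf2 hmχ hmχ2,
    integral_oscIntegral_mul hmf χ.integrable, ← integral_neg_eq_self, ← mul_neg, ← integral_neg]
  congr 2 with y
  rw [neg_neg, hodd]
  ring

end Multiplier

section PotentialDiff

variable {d : ℕ} (ε : ℝ) (V : Pos d →ᵇ ℝ)

lemma potentialDiff_neg (x y : Pos d) : potentialDiff ε V x (-y) = -potentialDiff ε V x y := by
  simp only [potentialDiff, smul_neg, sub_neg_eq_add, ← sub_eq_add_neg]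
  ring

lemma continuous_potentialDiff : Continuous fun w : Phase d => potentialDiff ε V w.1 w.2 := by
  unfold potentialDiff
  fun_prop

lemma norm_potentialDiff_le (x y : Pos d) : ‖(potentialDiff ε V x y : ℂ)‖ ≤ 2 * ‖V‖ / |ε| := by
  rw [Complex.norm_real, potentialDiff, norm_mul, one_div, norm_inv, Real.norm_eq_abs ε,
    inv_mul_eq_div]
  gcongr
  refine (norm_sub_le _ _).trans ?_
  linarith [V.norm_coe_le_norm (x + (ε / 2) • y), V.norm_coe_le_norm (x - (ε / 2) • y)]

lemma memLp_potentialDiff (x : Pos d) : MemLp (fun y => (potentialDiff ε V x y : ℂ)) ⊤ volume :=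
  memLp_top_of_bound (Complex.continuous_ofReal.comp ((continuous_potentialDiff ε V).comp
    (by fun_prop : Continuous fun y : Pos d => (x, y)))).aestronglyMeasurable _
    (ae_of_all _ (norm_potentialDiff_le ε V x))

end PotentialDiff

section WignerOp

variable {d : ℕ} (ε : ℝ) (V : Pos d →ᵇ ℝ) (χ : SchwartzMap (Phase d) ℂ)

/-- The function `(x, y) ↦ δ[V](x, y) ∫ e^{-i y·p} χ(x, p) dp`, whose Fourier transform in `y` is
the image of `χ` under the potential operator, up to a factor. -/
def wignerSymbol (w : Phase d) : ℂ :=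
  potentialDiff ε V w.1 w.2 * oscIntegral (fibre χ w.1) (-w.2)

lemma wignerOp_eq_oscIntegral (w : Phase d) :
    wignerOp ε V χ w = (Complex.I / (2 * Real.pi : ℂ) ^ d) *
      oscIntegral (fun y => wignerSymbol ε V χ (w.1, y)) w.2 := by
  rw [wignerOp, oscIntegral]
  congr 2 with y
  rw [wignerSymbol, oscIntegral, ← integral_const_mul, ← integral_const_mul]
  congr 1 with p
  rw [inner_sub_right, sub_eq_add_neg, cis_add, inner_neg_left, real_inner_comm w.2 y, fibre_apply]
  ring

lemma stronglyMeasurable_wignerSymbol : StronglyMeasurable (wignerSymbol ε V χ) :=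
  (Complex.continuous_ofReal.comp (continuous_potentialDiff ε V)).stronglyMeasurable.mul <|
    (stronglyMeasurable_oscIntegral_snd (F := χ) χ.continuous.stronglyMeasurable).comp_measurable
      (g := fun w : Phase d => (w.1, -w.2)) (by fun_prop)

lemma integrable_wignerSymbol (x : Pos d) : Integrable fun y => wignerSymbol ε V χ (x, y) :=
  (integrable_oscIntegral_neg (fibre χ x)).mul_of_top_right (memLp_potentialDiff ε V x)

lemma memLp_wignerSymbol (x : Pos d) : MemLp (fun y => wignerSymbol ε V χ (x, y)) 2 :=
  ((memLp_oscIntegral (fibre χ x).integrable ((fibre χ x).memLp 2)).comp_measurePreserving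
    (Measure.measurePreserving_neg volume)).mul' (memLp_potentialDiff ε V x)

lemma stronglyMeasurable_wignerOp : StronglyMeasurable (wignerOp ε V χ) := by
  rw [funext (wignerOp_eq_oscIntegral ε V χ)]
  exact (stronglyMeasurable_oscIntegral_snd (stronglyMeasurable_wignerSymbol ε V χ)).const_mul _

lemma lintegral_oscIntegral_fibre_neg :
    ∫⁻ w : Phase d, ‖oscIntegral (fibre χ w.1) (-w.2)‖ₑ ^ 2 =
      ENNReal.ofReal ((2 * Real.pi) ^ d) * ∫⁻ w, ‖χ w‖ₑ ^ 2 := by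
  have hneg : MeasurePreserving (fun w : Phase d => (w.1, -w.2)) volume volume :=
    (MeasurePreserving.id (volume : Measure (Pos d))).prod (Measure.measurePreserving_neg volume)
  have hplancherel := lintegral_oscIntegral_snd (μ := (volume : Measure (Pos d))) (F := χ)
    χ.continuous.stronglyMeasurable (ae_of_all _ fun x => (fibre χ x).integrable)
    (ae_of_all _ fun x => (fibre χ x).memLp 2 volume)
  rw [finrank_euclideanSpace_fin] at hplancherel
  exact (hneg.lintegral_comp ((stronglyMeasurable_oscIntegral_snd
    χ.continuous.stronglyMeasurable).measurable.enorm.pow_const 2)).trans hplancherel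

lemma lintegral_wignerSymbol_le : ∫⁻ w, ‖wignerSymbol ε V χ w‖ₑ ^ 2 ≤
    ENNReal.ofReal (2 * ‖V‖ / |ε|) ^ 2 *
      (ENNReal.ofReal ((2 * Real.pi) ^ d) * ∫⁻ w, ‖χ w‖ₑ ^ 2) := by
  rw [← lintegral_oscIntegral_fibre_neg, ← lintegral_const_mul' _ _ (by finiteness)]
  refine lintegral_mono fun w => ?_
  rw [wignerSymbol, enorm_mul, mul_pow]
  gcongr
  rw [← ofReal_norm]
  exact ENNReal.ofReal_le_ofReal (norm_potentialDiff_le ε V _ _)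

lemma eLpNorm_wignerOp_le :
    eLpNorm (wignerOp ε V χ) 2 volume ≤
      ENNReal.ofReal (2 * ‖V‖ / |ε|) * eLpNorm χ 2 volume := by
  have hconst : ‖Complex.I / (2 * Real.pi : ℂ) ^ d‖ₑ ^ 2 *
      (ENNReal.ofReal ((2 * Real.pi) ^ d) * ENNReal.ofReal ((2 * Real.pi) ^ d)) = 1 := by
    rw [← ofReal_norm, ← ENNReal.ofReal_pow (by positivity), ← ENNReal.ofReal_mul (by positivity),
      ← ENNReal.ofReal_mul (by positivity), ← ENNReal.ofReal_one]
    congr 1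
    simp only [norm_div, Complex.norm_I, norm_pow, norm_mul, Complex.norm_ofNat, Complex.norm_real,
      Real.norm_of_nonneg Real.pi_pos.le]
    field_simp
  have hsq : ∀ w, ‖wignerOp ε V χ w‖ₑ ^ 2 = ‖Complex.I / (2 * Real.pi : ℂ) ^ d‖ₑ ^ 2 *
      ‖oscIntegral (fun y => wignerSymbol ε V χ (w.1, y)) w.2‖ₑ ^ 2 := fun w => by
    rw [wignerOp_eq_oscIntegral, enorm_mul, mul_pow]
  rw [← ENNReal.pow_le_pow_left_iff two_ne_zero, mul_pow, ← lintegral_enorm_sq,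
    ← lintegral_enorm_sq, lintegral_congr hsq, lintegral_const_mul' _ _ (by finiteness),
    Measure.volume_eq_prod, lintegral_oscIntegral_snd (stronglyMeasurable_wignerSymbol ε V χ)
      (ae_of_all _ (integrable_wignerSymbol ε V χ)) (ae_of_all _ (memLp_wignerSymbol ε V χ)),
    ← Measure.volume_eq_prod, finrank_euclideanSpace_fin]
  refine (mul_le_mul_right (mul_le_mul_right (lintegral_wignerSymbol_le ε V χ) _) _).trans_eq ?_
  rw [mul_left_comm (ENNReal.ofReal (2 * ‖V‖ / |ε|) ^ 2), ← mul_assoc (ENNReal.ofReal _),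
    ← mul_assoc (‖_‖ₑ ^ 2), hconst, one_mul]

lemma memLp_wignerOp : MemLp (wignerOp ε V χ) 2 :=
  ⟨(stronglyMeasurable_wignerOp ε V χ).aestronglyMeasurable, (eLpNorm_wignerOp_le ε V χ).trans_lt
    (ENNReal.mul_lt_top ENNReal.ofReal_lt_top (χ.memLp 2 volume).2)⟩

lemma norm_toLp_wignerOp_le :
    ‖(memLp_wignerOp ε V χ).toLp‖ ≤ 2 * ‖V‖ / |ε| * ‖χ.toLp 2‖ := by
  rw [Lp.norm_toLp, SchwartzMap.norm_toLp,
    ← ENNReal.toReal_ofReal (by positivity : 0 ≤ 2 * ‖V‖ / |ε|), ← ENNReal.toReal_mul]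
  exact ENNReal.toReal_mono (ENNReal.mul_ne_top ENNReal.ofReal_ne_top (χ.memLp 2 volume).2.ne)
    (eLpNorm_wignerOp_le ε V χ)

variable {ε χ}

lemma ae_chordProduct_potentialGen (hε : ε ≠ 0) (φ ψ : WaveSpace d) (x : Pos d) :
    ∀ᵐ y, chordProduct ε (potentialGen ε V φ) ψ (x, y) +
        chordProduct ε φ (potentialGen ε V ψ) (x, y) =
      Complex.I * (potentialDiff ε V x y * chordProduct ε φ ψ (x, y)) := by
  have hendpoint : ∀ (φ : WaveSpace d) {r : ℝ}, r ≠ 0 → ∀ᵐ y, potentialGen ε V φ (x + r • y) =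
      1 / (Complex.I * ε) * (V (x + r • y) * φ (x + r • y)) := fun φ r hr =>
    ((measurePreserving_add_left volume x).quasiMeasurePreserving.comp
      (Measure.quasiMeasurePreserving_smul volume hr)).ae (coeFn_potentialGen ε V φ)
  filter_upwards [hendpoint φ (r := -(ε / 2)) (by simpa using hε),
    hendpoint ψ (r := ε / 2) (by simpa using hε)] with y hleft hright
  rw [neg_smul, ← sub_eq_add_neg] at hleft
  have hεC : (ε : ℂ) ≠ 0 := Complex.ofReal_ne_zero.2 hε
  simp only [chordProduct, chord, hleft, hright, potentialDiff, map_mul, map_div₀, map_one,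
    Complex.conj_I, Complex.conj_ofReal]
  push_cast
  field_simp
  linear_combination (φ (x - (ε / 2) • y) * conj (ψ (x + (ε / 2) • y)) *
    (V (x - (ε / 2) • y) - V (x + (ε / 2) • y))) * Complex.I_sq

lemma wignerTransform_potentialGen (hε : ε ≠ 0) (φ ψ : WaveSpace d) (w : Phase d) :
    wignerTransform ε (potentialGen ε V φ) ψ w + wignerTransform ε φ (potentialGen ε V ψ) w =
      (Complex.I / (2 * Real.pi : ℂ) ^ d) *
        oscIntegral (fun y => potentialDiff ε V w.1 y * chordProduct ε φ ψ (w.1, y)) w.2 := by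
  have hint : ∀ φ ψ : WaveSpace d,
      Integrable fun y => cis (inner ℝ w.2 y) * chordProduct ε φ ψ (w.1, y) := fun φ ψ =>
    (integrable_chordProduct hε (Lp.memLp φ) (Lp.memLp ψ) w.1).mul_of_top_right
      (memLp_cis_inner w.2)
  simp only [wignerTransform_eq_oscIntegral, oscIntegral]
  rw [← mul_add, ← integral_add (hint _ _) (hint _ _), div_eq_mul_one_div Complex.I,
    mul_comm Complex.I, mul_assoc, ← integral_const_mul Complex.I]
  refine congrArg _ (integral_congr_ae ?_)
  filter_upwards [ae_chordProduct_potentialGen V hε φ ψ w.1] with y hy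
  linear_combination cis (inner ℝ w.2 y) * hy

lemma integral_wignerTransform_mul_wignerOp (hε : 0 < ε) (φ ψ : WaveSpace d) :
    ∫ w, (wignerTransform ε (potentialGen ε V φ) ψ w +
      wignerTransform ε φ (potentialGen ε V ψ) w) * χ w =
      -∫ w, wignerTransform ε φ ψ w * wignerOp ε V χ w := by
  have hleft : Integrable fun w => (wignerTransform ε (potentialGen ε V φ) ψ w +
      wignerTransform ε φ (potentialGen ε V ψ) w) * χ w :=
    ((memLp_wignerTransform hε _ _).add (memLp_wignerTransform hε _ _)).integrable_mul (χ.memLp 2)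
  have hright : Integrable fun w => wignerTransform ε φ ψ w * wignerOp ε V χ w :=
    (memLp_wignerTransform hε _ _).integrable_mul (memLp_wignerOp ε V χ)
  rw [Measure.volume_eq_prod] at hleft hright ⊢
  rw [integral_prod _ hleft, integral_prod _ hright, ← integral_neg]
  refine integral_congr_ae ?_
  filter_upwards [ae_memLp_chordProduct hε (Lp.stronglyMeasurable φ) (Lp.stronglyMeasurable ψ)
    (Lp.memLp φ) (Lp.memLp ψ)] with x hx
  have hskew := integral_oscIntegral_mul_oscIntegral_multiplier (memLp_potentialDiff ε V x)
    (fun y => by rw [potentialDiff_neg, Complex.ofReal_neg])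
    (integrable_chordProduct hε.ne' (Lp.memLp φ) (Lp.memLp ψ) x) hx (fibre χ x)
  have hpi : (2 * Real.pi : ℂ) ^ d ≠ 0 := pow_ne_zero _ (by simp [Real.pi_ne_zero])
  simp only [wignerTransform_potentialGen V hε.ne', wignerTransform_eq_oscIntegral ε φ ψ,
    wignerOp_eq_oscIntegral, mul_mul_mul_comm (1 / _ : ℂ), mul_assoc (Complex.I / _),
    integral_const_mul]
  rw [finrank_euclideanSpace_fin] at hskew
  simp only [wignerSymbol, hskew, fibre_apply]
  field_simp

end WignerOp

/-! ### Existence and uniqueness of Wigner solutions -/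

section Existence

variable {d : ℕ} {ε : ℝ}

lemma integral_mul_transport_sub_wignerOp (V : Pos d →ᵇ ℝ) (χ : SchwartzMap (Phase d) ℂ)
    (u : PhaseSpaceL2 d) :
    ∫ w, u w * (transport χ w - wignerOp ε V χ w) =
      (∫ w, u w * transport χ w) - ∫ w, u w * wignerOp ε V χ w := by
  simp only [mul_sub]
  exact integral_sub ((Lp.memLp u).integrable_mul (memLp_transport χ))
    ((Lp.memLp u).integrable_mul (memLp_wignerOp ε V χ))

variable (hε : 0 < ε)

lemma integral_wignerL2_mul (φ ψ : WaveSpace d) (c : Phase d → ℂ) :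
    ∫ w, wignerL2 hε φ ψ w * c w = ∫ w, wignerTransform ε φ ψ w * c w :=
  integral_congr_ae ((coeFn_wignerL2 hε φ ψ).mono fun w hw => by simp only [hw])

lemma integral_wignerL2_backFlow_mul_comp_shear (s : ℝ) (φ ψ : WaveSpace d) (c : Phase d → ℂ) :
    ∫ w, wignerL2 hε (backFlow ε s φ) (backFlow ε s ψ) w * c (shear s w) =
      ∫ w, wignerL2 hε φ ψ w * c w := by
  rw [integral_wignerL2_mul hε φ, ← integral_comp_shear s fun w => wignerTransform ε φ ψ w * c w,
    integral_wignerL2_mul hε _ _ fun w => c (shear s w)]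
  simp only [wignerTransform_backFlow hε]

lemma integral_wignerL2_potentialGen_mul (V : Pos d →ᵇ ℝ) (φ ψ : WaveSpace d)
    (χ : SchwartzMap (Phase d) ℂ) :
    (∫ w, wignerL2 hε φ (potentialGen ε V ψ) w * χ w) +
        ∫ w, wignerL2 hε (potentialGen ε V φ) ψ w * χ w =
      -∫ w, wignerL2 hε φ ψ w * wignerOp ε V χ w := by
  have hint : ∀ φ ψ : WaveSpace d, Integrable fun w => wignerTransform ε φ ψ w * χ w :=
    fun φ ψ => (memLp_wignerTransform hε φ ψ).integrable_mul (χ.memLp 2)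
  rw [integral_wignerL2_mul, integral_wignerL2_mul, integral_wignerL2_mul,
    ← integral_wignerTransform_mul_wignerOp V hε, add_comm, ← integral_add (hint _ _) (hint _ _)]
  simp only [add_mul]

variable {T : ℝ} {V : Pos d →ᵇ ℝ} {φ ψ : ℝ → WaveSpace d}

lemma hasDerivWithinAt_wignerL2_backFlow (hφ : IsSchrodingerSolution ε T V φ)
    (hψ : IsSchrodingerSolution ε T V ψ) {t : ℝ} (ht : t ∈ Set.Icc 0 T) :
    HasDerivWithinAt (fun s => wignerL2 hε (backFlow ε s (φ s)) (backFlow ε s (ψ s)))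
      (wignerL2 hε (backFlow ε t (φ t)) (backFlow ε t (potentialGen ε V (ψ t))) +
        wignerL2 hε (backFlow ε t (potentialGen ε V (φ t))) (backFlow ε t (ψ t)))
      (Set.Icc 0 T) t :=
  (wignerL2 hε).hasDerivWithinAt_of_bilinear (hφ.hasDerivWithinAt_backFlow hε.ne' ht)
    (hψ.hasDerivWithinAt_backFlow hε.ne' ht)

lemma isWignerSolution_wignerL2 (hφ : IsSchrodingerSolution ε T V φ)
    (hψ : IsSchrodingerSolution ε T V ψ) :
    IsWignerSolution ε T V (fun t => wignerL2 hε (φ t) (ψ t)) where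
  continuousOn :=
    ((wignerL2 hε).continuous.comp_continuousOn hφ.continuousOn).clm_apply hψ.continuousOn
  weak χ t ht := by
    have hχ : ∀ s, MemLp (fun w => χ (shear s w)) 2 := fun s => (shearComp s χ).memLp 2 volume
    have htransport : MemLp (fun w => transport χ (shear t w)) 2 :=
      (shearComp t (transportS χ)).memLp 2 volume
    obtain ⟨G, hG, hbound⟩ := exists_memLp_bound_transport_comp_shear χ T
    have hpulled := hasDerivWithinAt_wignerL2_backFlow hε hφ hψ ht
    have hfrozen := ((pairing volume).flip (hχ t).toLp).hasFDerivAt.restrictScalars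
      ℝ |>.comp_hasDerivWithinAt t hpulled
    simp only [Function.comp_def, ContinuousLinearMap.coe_restrictScalars', map_add,
      ContinuousLinearMap.flip_apply, pairing_toLp] at hfrozen
    have hmoving := hasDerivWithinAt_integral_mul (convex_Icc 0 T) ht hpulled.continuousWithinAt
      hχ htransport hG (fun s _ w => (hasDerivAt_comp_shear χ w s).hasDerivWithinAt)
      (fun s hs w => hbound s ((abs_of_nonneg hs.1).trans_le hs.2) w) hfrozen
    simp only [integral_wignerL2_backFlow_mul_comp_shear hε] at hmoving
    refine hmoving.congr_deriv ?_
    rw [integral_wignerL2_potentialGen_mul, integral_mul_transport_sub_wignerOp]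
    ring

end Existence

section Uniqueness

variable {d : ℕ} {ε T : ℝ} {V : Pos d →ᵇ ℝ}

lemma norm_integral_mul_wignerOp_shearComp_le (h : PhaseSpaceL2 d) (s : ℝ)
    (χ : SchwartzMap (Phase d) ℂ) :
    ‖∫ w, h w * wignerOp ε V (shearComp s χ) w‖ ≤ 2 * ‖V‖ / |ε| * ‖h‖ * ‖χ.toLp 2‖ := by
  rw [← pairing_toLp h (memLp_wignerOp ε V _), ← norm_toLp_shearComp s χ, mul_right_comm,
    mul_comm _ ‖h‖]
  exact (norm_pairing_le _ _).trans (by gcongr; exact norm_toLp_wignerOp_le ε V _)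

lemma norm_le_of_forall_schwartz_comp_shear {h : PhaseSpaceL2 d} (t : ℝ) {M : ℝ} (hM0 : 0 ≤ M)
    (hM : ∀ χ : SchwartzMap (Phase d) ℂ, ‖∫ w, h w * χ (shear t w)‖ ≤ M * ‖χ.toLp 2‖) :
    ‖h‖ ≤ M := by
  refine norm_le_of_forall_schwartz hM0 fun χ => ?_
  simpa only [shearComp_apply, shear_shear, neg_add_cancel, shear_zero, norm_toLp_shearComp]
    using hM (shearComp (-t) χ)

lemma IsWignerSolution.hasDerivWithinAt_integral_sub_mul {f g : ℝ → PhaseSpaceL2 d}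
    (hf : IsWignerSolution ε T V f) (hg : IsWignerSolution ε T V g) (χ : SchwartzMap (Phase d) ℂ)
    {t : ℝ} (ht : t ∈ Set.Icc 0 T) :
    HasDerivWithinAt (fun s => ∫ w, (f - g) s w * χ w)
      ((∫ w, (f - g) t w * transport χ w) - ∫ w, (f - g) t w * wignerOp ε V χ w)
      (Set.Icc 0 T) t := by
  have hdiff : ∀ s {c : Phase d → ℂ}, MemLp c 2 →
      ∫ w, (f - g) s w * c w = (∫ w, f s w * c w) - ∫ w, g s w * c w := fun s c hc => by
    simp only [← pairing_toLp _ hc, Pi.sub_apply, map_sub, sub_apply]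
  simp only [hdiff _ (χ.memLp 2 volume), hdiff _ (memLp_transport χ),
    hdiff _ (memLp_wignerOp ε V χ)]
  refine ((hf.weak χ t ht).sub (hg.weak χ t ht)).congr_deriv ?_
  rw [integral_mul_transport_sub_wignerOp, integral_mul_transport_sub_wignerOp]
  ring

lemma IsWignerSolution.hasDerivWithinAt_integral_sub_mul_comp_shear {f g : ℝ → PhaseSpaceL2 d}
    (hf : IsWignerSolution ε T V f) (hg : IsWignerSolution ε T V g) (χ : SchwartzMap (Phase d) ℂ)
    {t : ℝ} (ht : t ∈ Set.Icc 0 T) :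
    HasDerivWithinAt (fun s => ∫ w, (f - g) s w * χ (shear (-s) w))
      (-∫ w, (f - g) t w * wignerOp ε V (shearComp (-t) χ) w) (Set.Icc 0 T) t := by
  have hχ : ∀ s, MemLp (fun w => χ (shear (-s) w)) 2 := fun s =>
    (shearComp (-s) χ).memLp 2 volume
  have htransport : MemLp (fun w => -transport χ (shear (-t) w)) 2 :=
    ((shearComp (-t) (transportS χ)).memLp 2 volume).neg
  obtain ⟨G, hG, hbound⟩ := exists_memLp_bound_transport_comp_shear χ T
  have hderiv : ∀ s w,
      HasDerivAt (fun s => χ (shear (-s) w)) (-transport χ (shear (-s) w)) s := fun s w => by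
    simpa [Function.comp_def] using
      (hasDerivAt_comp_shear χ w (-s)).scomp s (hasDerivAt_neg s)
  have hmoving := hasDerivWithinAt_integral_mul (convex_Icc 0 T) ht
    ((hf.continuousOn.sub hg.continuousOn) t ht) hχ htransport hG
    (fun s _ w => (hderiv s w).hasDerivWithinAt)
    (fun s hs w => by
      rw [norm_neg]
      exact hbound (-s) ((abs_neg s).trans_le ((abs_of_nonneg hs.1).trans_le hs.2)) w)
    (hf.hasDerivWithinAt_integral_sub_mul hg (shearComp (-t) χ) ht)
  refine hmoving.congr_deriv ?_
  simp only [transport_shearComp, mul_neg, integral_neg]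
  ring

lemma IsWignerSolution.norm_sub_le {f g : ℝ → PhaseSpaceL2 d}
    (hf : IsWignerSolution ε T V f) (hg : IsWignerSolution ε T V g) {s t M : ℝ}
    (hs : s ∈ Set.Icc 0 T) (hs0 : (f - g) s = 0) (ht : t ∈ Set.Icc 0 T)
    (hM : ∀ r ∈ Set.uIcc s t, ‖(f - g) r‖ ≤ M) :
    ‖(f - g) t‖ ≤ 2 * ‖V‖ / |ε| * |t - s| * M := by
  have hM0 : 0 ≤ M := (norm_nonneg _).trans (hM s Set.left_mem_uIcc)
  refine norm_le_of_forall_schwartz_comp_shear (-t) (by positivity) fun χ => ?_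
  have hsub : Set.uIcc s t ⊆ Set.Icc 0 T := Set.ordConnected_Icc.uIcc_subset hs ht
  have hmean := (convex_uIcc s t).norm_image_sub_le_of_norm_hasDerivWithin_le
    (fun r hr => (hf.hasDerivWithinAt_integral_sub_mul_comp_shear hg χ (hsub hr)).mono hsub)
    (C := 2 * ‖V‖ / |ε| * M * ‖χ.toLp 2‖)
    (fun r hr => by
      rw [norm_neg]
      exact (norm_integral_mul_wignerOp_shearComp_le _ _ _).trans (by gcongr; exact hM r hr))
    Set.left_mem_uIcc Set.right_mem_uIcc
  have hstart : ∫ w, (f - g) s w * χ (shear (-s) w) = 0 := by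
    rw [hs0]
    exact integral_eq_zero_of_ae ((Lp.coeFn_zero ℂ 2 volume).mono fun w hw =>
      mul_eq_zero_of_left hw _)
  rw [hstart, sub_zero, Real.norm_eq_abs] at hmean
  linarith

lemma IsWignerSolution.eqOn_of_eq {f g : ℝ → PhaseSpaceL2 d} (hf : IsWignerSolution ε T V f)
    (hg : IsWignerSolution ε T V g) {t₀ : ℝ} (ht₀ : t₀ ∈ Set.Icc 0 T) (h₀ : f t₀ = g t₀) :
    Set.EqOn f g (Set.Icc 0 T) := by
  have hzero := eqOn_zero_of_norm_le_mul_abs_sub (h := f - g) (convex_Icc 0 T) (by positivity)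
    (hf.continuousOn.sub hg.continuousOn)
    (fun s hs hs0 t ht M hM => hf.norm_sub_le hg hs hs0 ht hM) ht₀ (sub_eq_zero.2 h₀)
  exact fun t ht => sub_eq_zero.1 (hzero ht)

end Uniqueness

/-! ### Products of wave functions -/

section BoundedPairing

variable {α : Type*} [MeasurableSpace α] {μ : Measure α}

/-- The functional `h ↦ ∫ h c` on `L¹` given by a bounded function `c`. -/
def boundedPairing {c : α → ℂ} (hc : MemLp c ⊤ μ) : Lp ℂ 1 μ →L[ℂ] ℂ :=
  ((ContinuousLinearMap.mul ℂ ℂ).lpPairing μ 1 ⊤).flip hc.toLp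

lemma boundedPairing_apply {c : α → ℂ} (hc : MemLp c ⊤ μ) (h : Lp ℂ 1 μ) :
    boundedPairing hc h = ∫ x, h x * c x ∂μ := by
  rw [boundedPairing, ContinuousLinearMap.flip_apply, ContinuousLinearMap.lpPairing_eq_integral]
  exact integral_congr_ae (hc.coeFn_toLp.mono fun x hx => by
    simp only [hx, ContinuousLinearMap.mul_apply'])

lemma continuous_star_Lp : Continuous (star : Lp ℂ 2 μ → Lp ℂ 2 μ) := by
  refine (LipschitzWith.of_dist_le_mul (K := 1) fun f g => ?_).continuous
  have hsub : star f - star g = star (f - g) := by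
    refine Lp.ext ?_
    filter_upwards [Lp.coeFn_sub (star f) (star g), Lp.coeFn_sub f g, Lp.coeFn_star f,
      Lp.coeFn_star g, Lp.coeFn_star (f - g)] with x hsub_star hsub hf hg hstar_sub
    simp only [hsub_star, hstar_sub, Pi.sub_apply, Pi.star_apply, hsub, hf, hg, star_sub]
  rw [dist_eq_norm, hsub, norm_star_Lp, NNReal.coe_one, one_mul, dist_eq_norm]

end BoundedPairing

section MulConj

variable {d : ℕ}

lemma oscIntegral_eq_boundedPairing (h : Lp ℂ 1 (volume : Measure (Pos d))) (p : Pos d) :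
    oscIntegral h p = boundedPairing (memLp_cis_inner p) h := by
  simp only [boundedPairing_apply, oscIntegral, mul_comm]

lemma toDistribution_eq_boundedPairing (h : Lp ℂ 1 (volume : Measure (Pos d)))
    (χ : SchwartzMap (Pos d) ℂ) :
    toDistribution h χ = boundedPairing (χ.memLp_top volume) h :=
  (boundedPairing_apply _ _).symm

lemma toDistribution_smul_sub_smul (a b : ℂ) (h k : Lp ℂ 1 (volume : Measure (Pos d))) :
    toDistribution (a • h - b • k) = a • toDistribution h - b • toDistribution k := by
  ext1 χ
  simp only [toDistribution_eq_boundedPairing, Pi.sub_apply, Pi.smul_apply, map_sub, map_smul]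

lemma coeFn_mulConj (φ ψ : WaveSpace d) :
    mulConj φ ψ =ᵐ[volume] fun x => φ x * conj (ψ x) :=
  Integrable.coeFn_toL1 _

lemma mulConj_eq_holder (φ ψ : WaveSpace d) :
    mulConj φ ψ = (ContinuousLinearMap.mul ℂ ℂ).holderL volume 2 2 1 φ (star ψ) := by
  refine Lp.ext ?_
  filter_upwards [coeFn_mulConj φ ψ, Lp.coeFn_star ψ,
    (ContinuousLinearMap.mul ℂ ℂ).coeFn_holder (r := 1) φ (star ψ)] with x hmul hstar hholder
  rw [hmul, ContinuousLinearMap.holderL_apply_apply, hholder, hstar]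
  rfl

lemma continuousOn_mulConj {s : Set ℝ} {φ ψ : ℝ → WaveSpace d} (hφ : ContinuousOn φ s)
    (hψ : ContinuousOn ψ s) : ContinuousOn (fun t => mulConj (φ t) (ψ t)) s := by
  simp only [mulConj_eq_holder]
  exact (((ContinuousLinearMap.mul ℂ ℂ).holderL volume 2 2 1).continuous.comp_continuousOn
    hφ).clm_apply (continuous_star_Lp.comp_continuousOn hψ)

lemma integral_mul_conj (φ ψ : WaveSpace d) : ∫ x, φ x * conj (ψ x) = inner ℂ ψ φ := by
  simp only [L2.inner_def, RCLike.inner_apply]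

lemma oscIntegral_mulConj (φ ψ : WaveSpace d) (p : Pos d) :
    oscIntegral (mulConj φ ψ) p = oscIntegral (fun x => φ x * conj (ψ x)) p :=
  integral_congr_ae ((coeFn_mulConj φ ψ).mono fun x hx => by simp only [hx])

end MulConj

/-! ### Correlations of Wigner transforms -/

section ChordCorrelation

open Module

variable {E : Type*} [NormedAddCommGroup E] [InnerProductSpace ℝ E] [FiniteDimensional ℝ E]
  [MeasurableSpace E] [BorelSpace E] {ε : ℝ} {f f₁ f₂ g g₁ g₂ : E → ℂ}

lemma memLp_chordProduct (hε : 0 < ε) (hf : StronglyMeasurable f) (hg : StronglyMeasurable g)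
    (hf2 : MemLp f 2) (hg2 : MemLp g 2) : MemLp (chordProduct ε f g) 2 := by
  rw [memLp_two_iff_lintegral_lt_top
    (stronglyMeasurable_chordProduct hf hg ε).aestronglyMeasurable,
    lintegral_enorm_chordProduct_sq hε hf hg]
  exact ENNReal.mul_lt_top ENNReal.ofReal_lt_top (ENNReal.mul_lt_top
    ((memLp_two_iff_lintegral_lt_top hf2.1).1 hf2) ((memLp_two_iff_lintegral_lt_top hg2.1).1 hg2))

lemma integral_conj_oscIntegral_mul_oscIntegral_add (hf : Integrable f) (hf2 : MemLp f 2)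
    (hg : Integrable g) (hg2 : MemLp g 2) (q : E) :
    ∫ k, conj (oscIntegral f k) * oscIntegral g (k + q) =
      (2 * Real.pi : ℂ) ^ finrank ℝ E * ∫ y, cis (inner ℝ q y) * (conj (f y) * g y) := by
  have hphase : Continuous fun y : E => cis (inner ℝ q y) := by fun_prop
  have hmod : Integrable fun y => cis (inner ℝ q y) * g y :=
    hg.bdd_mul (c := 1) hphase.aestronglyMeasurable (ae_of_all _ fun y => (norm_cis _).le)
  have hmod2 : MemLp (fun y => cis (inner ℝ q y) * g y) 2 :=
    hg2.congr_norm hmod.aestronglyMeasurable (ae_of_all _ fun y => by simp)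
  have hshift : ∀ k, oscIntegral g (k + q) = oscIntegral (fun y => cis (inner ℝ q y) * g y) k :=
    fun k => by simp only [oscIntegral, inner_add_left, cis_add, mul_assoc]
  simp only [hshift, integral_conj_oscIntegral_mul_oscIntegral hf hf2 hmod hmod2,
    mul_left_comm (conj _) (cis _)]

lemma integral_chord_fst_mul_chord_snd (hε : 0 < ε) (hf : AEStronglyMeasurable f)
    (hg : AEStronglyMeasurable g) :
    ∫ w : E × E, f (chord ε w).1 * g (chord ε w).2 =
      ((ε : ℂ) ^ finrank ℝ E)⁻¹ * ((∫ x, f x) * ∫ x, g x) := by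
  rw [integral_comp_chord hε (F := fun w => f w.1 * g w.2) (hf.comp_fst.mul hg.comp_snd),
    Measure.volume_eq_prod, integral_prod_mul]

lemma aestronglyMeasurable_cis_inner_mul (p : E) (hf : AEStronglyMeasurable f) :
    AEStronglyMeasurable fun x => cis (inner ℝ p x) * f x :=
  (by fun_prop : Continuous fun x : E => cis (inner ℝ p x)).aestronglyMeasurable.mul hf

-- With the shift `q = (ε / 2) p` the phase is `p` applied to the second endpoint of the chord,
-- and with `q = -(ε / 2) p` it is `p` applied to the first one.
lemma integral_cis_half_smul_mul_chordProduct (hε : 0 < ε) (hf₁ : AEStronglyMeasurable f₁)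
    (hf₂ : AEStronglyMeasurable f₂) (hg₁ : AEStronglyMeasurable g₁)
    (hg₂ : AEStronglyMeasurable g₂) (p : E) :
    ∫ w : E × E, cis (inner ℝ p w.1 + inner ℝ ((ε / 2) • p) w.2) *
        (conj (chordProduct ε g₁ g₂ w) * chordProduct ε f₁ f₂ w) =
      ((ε : ℂ) ^ finrank ℝ E)⁻¹ *
        ((∫ x, f₁ x * conj (g₁ x)) * oscIntegral (fun x => g₂ x * conj (f₂ x)) p) := by
  rw [oscIntegral, ← integral_chord_fst_mul_chord_snd hε (f := fun x => f₁ x * conj (g₁ x))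
    (g := fun x => cis (inner ℝ p x) * (g₂ x * conj (f₂ x))) (hf₁.mul hg₁.star)
    (aestronglyMeasurable_cis_inner_mul p (hg₂.mul hf₂.star))]
  congr 1 with w
  simp only [chord, chordProduct, inner_add_right, inner_smul_right, inner_smul_left, map_mul,
    Complex.conj_conj, conj_trivial]
  ring

lemma integral_cis_neg_half_smul_mul_chordProduct (hε : 0 < ε) (hf₁ : AEStronglyMeasurable f₁)
    (hf₂ : AEStronglyMeasurable f₂) (hg₁ : AEStronglyMeasurable g₁)
    (hg₂ : AEStronglyMeasurable g₂) (p : E) :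
    ∫ w : E × E, cis (inner ℝ p w.1 + inner ℝ (-((ε / 2) • p)) w.2) *
        (conj (chordProduct ε g₁ g₂ w) * chordProduct ε f₁ f₂ w) =
      ((ε : ℂ) ^ finrank ℝ E)⁻¹ *
        (oscIntegral (fun x => f₁ x * conj (g₁ x)) p * ∫ x, g₂ x * conj (f₂ x)) := by
  rw [oscIntegral, ← integral_chord_fst_mul_chord_snd hε
    (f := fun x => cis (inner ℝ p x) * (f₁ x * conj (g₁ x))) (g := fun x => g₂ x * conj (f₂ x))
    (aestronglyMeasurable_cis_inner_mul p (hf₁.mul hg₁.star)) (hg₂.mul hf₂.star)]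
  congr 1 with w
  simp only [chord, chordProduct, inner_sub_right, inner_smul_right, inner_neg_left,
    inner_smul_left, map_mul, Complex.conj_conj, conj_trivial, ← sub_eq_add_neg]
  ring

end ChordCorrelation

section WignerCorrelation

variable {d : ℕ} {ε : ℝ}

lemma measurePreserving_add_snd {X E : Type*} [MeasurableSpace X] [MeasurableSpace E] [AddGroup E]
    [MeasurableAdd E] (μ : Measure X) (ν : Measure E) [SFinite μ] [SFinite ν]
    [ν.IsAddRightInvariant] (q : E) :
    MeasurePreserving (fun w : X × E => (w.1, w.2 + q)) (μ.prod ν) (μ.prod ν) :=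
  (MeasurePreserving.id μ).prod (measurePreserving_add_right ν q)

lemma integrable_cis_mul_conj_wignerTransform_mul (hε : 0 < ε) (ψ₁ ψ₂ φ₁ φ₂ : WaveSpace d)
    (p q : Pos d) :
    Integrable fun w : Phase d => cis (inner ℝ p w.1) *
      (conj (wignerTransform ε ψ₁ ψ₂ w) * wignerTransform ε φ₁ φ₂ (w.1, w.2 + q)) :=
  ((memLp_wignerTransform hε ψ₁ ψ₂).star.integrable_mul
    ((memLp_wignerTransform hε φ₁ φ₂).comp_measurePreserving
      (measurePreserving_add_snd volume volume q))).bdd_mul (c := 1)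
    (by fun_prop : Continuous fun w : Phase d => cis (inner ℝ p w.1)).aestronglyMeasurable
    (ae_of_all _ fun _ => (norm_cis _).le)

lemma integrable_cis_mul_conj_chordProduct_mul (hε : 0 < ε) (ψ₁ ψ₂ φ₁ φ₂ : WaveSpace d)
    (p q : Pos d) :
    Integrable fun w : Phase d => cis (inner ℝ p w.1 + inner ℝ q w.2) *
      (conj (chordProduct ε ψ₁ ψ₂ w) * chordProduct ε φ₁ φ₂ w) := by
  have hmem : ∀ φ ψ : WaveSpace d, MemLp (chordProduct ε φ ψ) 2 := fun φ ψ =>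
    memLp_chordProduct hε (Lp.stronglyMeasurable φ) (Lp.stronglyMeasurable ψ) (Lp.memLp φ)
      (Lp.memLp ψ)
  exact ((hmem ψ₁ ψ₂).star.integrable_mul (hmem φ₁ φ₂)).bdd_mul (c := 1)
    (by fun_prop : Continuous fun w : Phase d =>
      cis (inner ℝ p w.1 + inner ℝ q w.2)).aestronglyMeasurable
    (ae_of_all _ fun _ => (norm_cis _).le)

lemma ae_integral_conj_wignerTransform_mul (hε : 0 < ε) (ψ₁ ψ₂ φ₁ φ₂ : WaveSpace d)
    (q : Pos d) :
    ∀ᵐ x : Pos d, ∫ k, conj (wignerTransform ε ψ₁ ψ₂ (x, k)) *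
        wignerTransform ε φ₁ φ₂ (x, k + q) =
      (1 / (2 * Real.pi : ℂ) ^ d) * ∫ y, cis (inner ℝ q y) *
        (conj (chordProduct ε ψ₁ ψ₂ (x, y)) * chordProduct ε φ₁ φ₂ (x, y)) := by
  have hmem : ∀ φ ψ : WaveSpace d, ∀ᵐ x : Pos d, MemLp (fun y => chordProduct ε φ ψ (x, y)) 2 :=
    fun φ ψ => ae_memLp_chordProduct hε (Lp.stronglyMeasurable φ) (Lp.stronglyMeasurable ψ)
      (Lp.memLp φ) (Lp.memLp ψ)
  filter_upwards [hmem ψ₁ ψ₂, hmem φ₁ φ₂] with x hψ hφ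
  have hparseval := integral_conj_oscIntegral_mul_oscIntegral_add
    (integrable_chordProduct hε.ne' (Lp.memLp ψ₁) (Lp.memLp ψ₂) x) hψ
    (integrable_chordProduct hε.ne' (Lp.memLp φ₁) (Lp.memLp φ₂) x) hφ q
  rw [finrank_euclideanSpace_fin] at hparseval
  have hconj : conj (1 / (2 * Real.pi : ℂ) ^ d) = 1 / (2 * Real.pi : ℂ) ^ d := by
    simp only [map_div₀, map_one, map_pow, map_mul, Complex.conj_ofReal, map_ofNat]
  simp only [wignerTransform_eq_oscIntegral, map_mul, hconj]
  simp only [mul_mul_mul_comm (1 / (2 * Real.pi : ℂ) ^ d)]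
  rw [integral_const_mul (1 / (2 * Real.pi : ℂ) ^ d * (1 / (2 * Real.pi : ℂ) ^ d)), hparseval]
  have := Real.pi_ne_zero
  field_simp

lemma integral_conj_wignerTransform_mul (hε : 0 < ε) (ψ₁ ψ₂ φ₁ φ₂ : WaveSpace d)
    (p q : Pos d) :
    ∫ w : Phase d, cis (inner ℝ p w.1) *
        (conj (wignerTransform ε ψ₁ ψ₂ w) * wignerTransform ε φ₁ φ₂ (w.1, w.2 + q)) =
      (1 / (2 * Real.pi : ℂ) ^ d) * ∫ w : Phase d, cis (inner ℝ p w.1 + inner ℝ q w.2) *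
        (conj (chordProduct ε ψ₁ ψ₂ w) * chordProduct ε φ₁ φ₂ w) := by
  rw [Measure.volume_eq_prod,
    integral_prod _ (integrable_cis_mul_conj_wignerTransform_mul hε ψ₁ ψ₂ φ₁ φ₂ p q),
    integral_prod _ (integrable_cis_mul_conj_chordProduct_mul hε ψ₁ ψ₂ φ₁ φ₂ p q),
    ← integral_const_mul]
  refine integral_congr_ae ?_
  filter_upwards [ae_integral_conj_wignerTransform_mul hε ψ₁ ψ₂ φ₁ φ₂ q] with x hx
  simp only [cis_add, mul_assoc, integral_const_mul (cis (inner ℝ p x)), hx]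
  ring

lemma ae_cis_mul_phaseDiff_wignerL2 (hε : 0 < ε) (ψ₁ ψ₂ φ₁ φ₂ : WaveSpace d) (p : Pos d) :
    ∀ᵐ w : Phase d, cis (inner ℝ p w.1) * conj (wignerL2 hε ψ₁ ψ₂ w) *
        phaseDiff ε (wignerL2 hε φ₁ φ₂) w.1 w.2 p = (1 / (ε : ℂ)) *
      (cis (inner ℝ p w.1) * (conj (wignerTransform ε ψ₁ ψ₂ w) *
        wignerTransform ε φ₁ φ₂ (w.1, w.2 + (ε / 2) • p)) -
       cis (inner ℝ p w.1) * (conj (wignerTransform ε ψ₁ ψ₂ w) *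
        wignerTransform ε φ₁ φ₂ (w.1, w.2 + -((ε / 2) • p)))) := by
  have hshift : ∀ q : Pos d, ∀ᵐ w : Phase d,
      wignerL2 hε φ₁ φ₂ (w.1, w.2 + q) = wignerTransform ε φ₁ φ₂ (w.1, w.2 + q) := fun q =>
    (measurePreserving_add_snd volume volume q).quasiMeasurePreserving.ae
      (coeFn_wignerL2 hε φ₁ φ₂)
  filter_upwards [coeFn_wignerL2 hε ψ₁ ψ₂, hshift ((ε / 2) • p), hshift (-((ε / 2) • p))]
    with w hw hplus hminus
  rw [phaseDiff, sub_eq_add_neg w.2, hw, hplus, hminus]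
  ring

lemma integral_cis_mul_phaseDiff_wignerL2 (hε : 0 < ε) (ψ₁ ψ₂ φ₁ φ₂ : WaveSpace d)
    (p : Pos d) :
    ∫ w : Phase d, cis (inner ℝ p w.1) * conj (wignerL2 hε ψ₁ ψ₂ w) *
        phaseDiff ε (wignerL2 hε φ₁ φ₂) w.1 w.2 p =
      (1 / (ε * (2 * Real.pi * ε : ℂ) ^ d)) *
        oscIntegral ((inner ℂ ψ₁ φ₁ : ℂ) • mulConj ψ₂ φ₂ - (inner ℂ φ₂ ψ₂ : ℂ) • mulConj φ₁ ψ₁ :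
          Lp ℂ 1 (volume : Measure (Pos d))) p := by
  have hm : ∀ φ : WaveSpace d, AEStronglyMeasurable φ := Lp.aestronglyMeasurable
  rw [integral_congr_ae (ae_cis_mul_phaseDiff_wignerL2 hε ψ₁ ψ₂ φ₁ φ₂ p), integral_const_mul,
    integral_sub (integrable_cis_mul_conj_wignerTransform_mul hε _ _ _ _ _ _)
      (integrable_cis_mul_conj_wignerTransform_mul hε _ _ _ _ _ _),
    integral_conj_wignerTransform_mul hε, integral_conj_wignerTransform_mul hε,
    integral_cis_half_smul_mul_chordProduct hε (hm _) (hm _) (hm _) (hm _),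
    integral_cis_neg_half_smul_mul_chordProduct hε (hm _) (hm _) (hm _) (hm _),
    integral_mul_conj, integral_mul_conj, ← oscIntegral_mulConj, ← oscIntegral_mulConj]
  simp only [oscIntegral_eq_boundedPairing, map_sub, map_smul, smul_eq_mul,
    finrank_euclideanSpace_fin, mul_pow]
  have := Real.pi_ne_zero
  field_simp

end WignerCorrelation

/-! ### Wigner and Schrödinger representatives -/

section Representatives

variable {d : ℕ} {ε T : ℝ} {f g : ℝ → PhaseSpaceL2 d}

lemma wignerRepIntegrand_eq_cis_mul (ε T : ℝ) (f g : ℝ → PhaseSpaceL2 d) (x p : Pos d) :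
    wignerRepIntegrand ε T f g x p = cis (-inner ℝ p x) * wignerRepIntegrand ε T f g 0 p := by
  rw [wignerRepIntegrand, wignerRepIntegrand, ← intervalIntegral.integral_const_mul]
  congr 1 with t
  rw [← integral_const_mul]
  congr 1 with w
  rw [sub_zero, inner_sub_right, sub_eq_add_neg, cis_add]
  ring

lemma wignerRepAt_eq_oscIntegral (ε T : ℝ) (f g : ℝ → PhaseSpaceL2 d) (x : Pos d) :
    wignerRepAt ε T f g x = (Complex.I / (2 * Real.pi : ℂ) ^ d) *
      oscIntegral (wignerRepIntegrand ε T f g 0) (-x) := by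
  simp only [wignerRepAt, oscIntegral, wignerRepIntegrand_eq_cis_mul ε T f g x, inner_neg_left,
    real_inner_comm]

lemma integral_cis_inner_sub_mul (f : Pos d → ℂ) (p z : Pos d) :
    ∫ x, cis (inner ℝ p (z - x)) * f x = cis (inner ℝ p z) * oscIntegral f (-p) := by
  rw [oscIntegral, ← integral_const_mul]
  congr 1 with x
  rw [inner_sub_right, sub_eq_add_neg, cis_add, inner_neg_left, mul_assoc]

lemma wignerRep_eq_integral (ε T : ℝ) (f g : ℝ → PhaseSpaceL2 d) (χ : SchwartzMap (Pos d) ℂ) :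
    wignerRep ε T f g χ = (Complex.I / (2 * Real.pi : ℂ) ^ d) *
      ∫ p, wignerRepIntegrand ε T f g 0 p * oscIntegral χ (-p) := by
  rw [wignerRep]
  congr 2 with p
  rw [wignerRepIntegrand, ← intervalIntegral.integral_mul_const]
  congr 1 with t
  rw [← integral_mul_const]
  congr 1 with w
  rw [integral_cis_inner_sub_mul, sub_zero]
  ring

lemma integral_wignerRepAt_mul (h : Integrable (wignerRepIntegrand ε T f g 0))
    (χ : SchwartzMap (Pos d) ℂ) :
    ∫ x, wignerRepAt ε T f g x * χ x = wignerRep ε T f g χ := by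
  simp only [wignerRepAt_eq_oscIntegral, wignerRep_eq_integral, mul_assoc]
  rw [integral_const_mul, ← integral_neg_eq_self]
  simp only [neg_neg]
  rw [integral_oscIntegral_mul h χ.integrable.comp_neg]
  simp only [oscIntegral_comp_neg]

lemma smul_wignerRep_eq_toDistribution {K : ℂ} {H : Lp ℂ 1 (volume : Measure (Pos d))}
    (h : ∀ p, K * wignerRepIntegrand ε T f g 0 p = -Complex.I * oscIntegral H p) :
    K • wignerRep ε T f g = toDistribution H := by
  ext1 χ
  have hinversion : ∫ p, oscIntegral H p * oscIntegral χ (-p) =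
      (2 * Real.pi : ℂ) ^ d * ∫ x, H x * χ x := by
    rw [integral_oscIntegral_mul (L1.integrable_coeFn H) (integrable_oscIntegral_neg χ),
      ← integral_const_mul]
    simp only [oscIntegral_oscIntegral_neg, finrank_euclideanSpace_fin,
      mul_left_comm _ ((2 * Real.pi : ℂ) ^ d)]
  have hpi : (2 * Real.pi : ℂ) ^ d ≠ 0 := pow_ne_zero _ (by simp [Real.pi_ne_zero])
  rw [Pi.smul_apply, smul_eq_mul, wignerRep_eq_integral, mul_left_comm, ← integral_const_mul]
  simp only [← mul_assoc K, h, mul_assoc (-Complex.I)]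
  rw [integral_const_mul, hinversion, toDistribution]
  field_simp
  rw [Complex.I_sq]
  ring

lemma ae_mul_wignerRepAt_eq {K : ℂ} {H : Lp ℂ 1 (volume : Measure (Pos d))}
    (h : K • wignerRep ε T f g = toDistribution H)
    (hi : Integrable (wignerRepIntegrand ε T f g 0)) :
    ∀ᵐ x, K * wignerRepAt ε T f g x = H x := by
  have hcont : Continuous fun x => K * wignerRepAt ε T f g x := by
    have := continuous_oscIntegral hi
    simp only [wignerRepAt_eq_oscIntegral]
    fun_prop
  refine ae_eq_of_forall_integral_mul_schwartz hcont.locallyIntegrable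
    (L1.integrable_coeFn H).locallyIntegrable fun χ => ?_
  simp only [mul_assoc]
  rw [integral_const_mul, integral_wignerRepAt_mul hi]
  exact congrFun h χ

variable {φ φ' ψ ψ' : ℝ → WaveSpace d}

lemma intervalIntegrable_mulConj (hT : 0 ≤ T) (hφ : ContinuousOn φ (Set.Icc 0 T))
    (hψ : ContinuousOn ψ (Set.Icc 0 T)) :
    IntervalIntegrable (fun t => mulConj (φ t) (ψ t)) volume 0 T :=
  (continuousOn_mulConj hφ hψ).intervalIntegrable_of_Icc hT

lemma integral_oscIntegral_mulConj_sub (hT : 0 ≤ T) (hφ : ContinuousOn φ (Set.Icc 0 T))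
    (hφ' : ContinuousOn φ' (Set.Icc 0 T)) (hψ : ContinuousOn ψ (Set.Icc 0 T))
    (hψ' : ContinuousOn ψ' (Set.Icc 0 T)) (a b : ℂ) (p : Pos d) :
    ∫ t in (0 : ℝ)..T, oscIntegral (a • mulConj (φ t) (ψ t) - b • mulConj (φ' t) (ψ' t) :
        Lp ℂ 1 (volume : Measure (Pos d))) p =
      oscIntegral (a • (∫ t in (0 : ℝ)..T, mulConj (φ t) (ψ t)) -
        b • ∫ t in (0 : ℝ)..T, mulConj (φ' t) (ψ' t) : Lp ℂ 1 (volume : Measure (Pos d))) p := by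
  have hint : IntervalIntegrable (fun t => a • mulConj (φ t) (ψ t)) volume 0 T :=
    (intervalIntegrable_mulConj hT hφ hψ).smul a
  have hint' : IntervalIntegrable (fun t => b • mulConj (φ' t) (ψ' t)) volume 0 T :=
    (intervalIntegrable_mulConj hT hφ' hψ').smul b
  simp only [oscIntegral_eq_boundedPairing]
  rw [ContinuousLinearMap.intervalIntegral_comp_comm _ (hint.sub hint'),
    intervalIntegral.integral_sub hint hint', intervalIntegral.integral_smul,
    intervalIntegral.integral_smul]

variable {V : Pos d →ᵇ ℝ}

lemma wignerRepIntegrand_zero_eq (hε : 0 < ε) (hT : 0 ≤ T) (hφ : IsSchrodingerSolution ε T V φ)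
    (hφ' : IsSchrodingerSolution ε T V φ') (hψ : IsSchrodingerSolution ε T V ψ)
    (hψ' : IsSchrodingerSolution ε T V ψ')
    (hf : Set.EqOn f (fun t => wignerL2 hε (φ t) (ψ' t)) (Set.Icc 0 T))
    (hg : Set.EqOn g (fun t => wignerL2 hε (ψ t) (φ' t)) (Set.Icc 0 T)) (p : Pos d) :
    wignerRepIntegrand ε T f g 0 p = (1 / (ε * (2 * Real.pi * ε : ℂ) ^ d)) *
      oscIntegral ((inner ℂ (ψ 0) (φ 0) : ℂ) • (∫ t in (0 : ℝ)..T, mulConj (φ' t) (ψ' t)) -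
        (inner ℂ (ψ' 0) (φ' 0) : ℂ) • ∫ t in (0 : ℝ)..T, mulConj (φ t) (ψ t) :
          Lp ℂ 1 (volume : Measure (Pos d))) p := by
  rw [wignerRepIntegrand, ← integral_oscIntegral_mulConj_sub hT hφ'.continuousOn hφ.continuousOn
    hψ'.continuousOn hψ.continuousOn, ← intervalIntegral.integral_const_mul]
  refine intervalIntegral.integral_congr fun t ht => ?_
  rw [Set.uIcc_of_le hT] at ht
  simp only [sub_zero, hf ht, hg ht]
  rw [integral_cis_mul_phaseDiff_wignerL2 hε, hφ.inner_eq_inner_zero hε.ne' hψ ht,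
    hφ'.inner_eq_inner_zero hε.ne' hψ' ht]

lemma wignerRep_of_eqOn_wignerL2 (hε : 0 < ε) (hT : 0 ≤ T) (hφ : IsSchrodingerSolution ε T V φ)
    (hφ' : IsSchrodingerSolution ε T V φ') (hψ : IsSchrodingerSolution ε T V ψ)
    (hψ' : IsSchrodingerSolution ε T V ψ')
    (hf : Set.EqOn f (fun t => wignerL2 hε (φ t) (ψ' t)) (Set.Icc 0 T))
    (hg : Set.EqOn g (fun t => wignerL2 hε (ψ t) (φ' t)) (Set.Icc 0 T)) :
    ((2 * Real.pi * ε : ℂ) ^ d) • wignerRep ε T f g =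
      toDistribution ((inner ℂ (ψ' 0) (φ' 0) : ℂ) • schrodingerRep ε T φ ψ -
        (inner ℂ (ψ 0) (φ 0) : ℂ) • schrodingerRep ε T φ' ψ') := by
  refine smul_wignerRep_eq_toDistribution fun p => ?_
  have hε0 : (ε : ℂ) ≠ 0 := by exact_mod_cast hε.ne'
  simp only [wignerRepIntegrand_zero_eq hε hT hφ hφ' hψ hψ' hf hg, schrodingerRep,
    oscIntegral_eq_boundedPairing, map_sub, map_smul, smul_eq_mul, mul_pow]
  field_simp
  ring

end Representatives

end InverseWigner

end

/-- The inner product `⟨u, v⟩ = ∫ u conj v`, linear in its first argument, is `inner ℂ v u` here. -/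
theorem mainTheorem1 (d : ℕ) (ε T : ℝ) (hε : 0 < ε) (hT : 0 < T)
    (Vb : BoundedContinuousFunction (EuclideanSpace ℝ (Fin d)) ℝ)
    (φI φI' ψT ψT' : InverseWigner.WaveSpace d)
    (φb φb' ψ ψ' : ℝ → InverseWigner.WaveSpace d)
    (hφb : InverseWigner.IsSchrodingerSolution ε T Vb φb) (hφI : φb 0 = φI)
    (hφb' : InverseWigner.IsSchrodingerSolution ε T Vb φb') (hφI' : φb' 0 = φI')
    (hψ : InverseWigner.IsSchrodingerSolution ε T Vb ψ) (hψT : ψ T = ψT)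
    (hψ' : InverseWigner.IsSchrodingerSolution ε T Vb ψ') (hψT' : ψ' T = ψT')
    (fI gT : InverseWigner.Phase d → ℂ)
    (hfI : fI = InverseWigner.wignerTransform ε φI (ψ' 0))
    (hgT : gT = InverseWigner.wignerTransform ε ψT (φb' T)) :
    -- existence and uniqueness of the background Wigner solution with initial data `fI`
    (∃ f : ℝ → InverseWigner.PhaseSpaceL2 d,
      (InverseWigner.IsWignerSolution ε T Vb f ∧ f 0 =ᵐ[volume] fI) ∧
      ∀ f₁ : ℝ → InverseWigner.PhaseSpaceL2 d,
        InverseWigner.IsWignerSolution ε T Vb f₁ → f₁ 0 =ᵐ[volume] fI →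
          Set.EqOn f₁ f (Set.Icc 0 T)) ∧
    -- existence and uniqueness of the adjoint Wigner solution with final data `gT`
    (∃ g : ℝ → InverseWigner.PhaseSpaceL2 d,
      (InverseWigner.IsWignerSolution ε T Vb g ∧ g T =ᵐ[volume] gT) ∧
      ∀ g₁ : ℝ → InverseWigner.PhaseSpaceL2 d,
        InverseWigner.IsWignerSolution ε T Vb g₁ → g₁ T =ᵐ[volume] gT →
          Set.EqOn g₁ g (Set.Icc 0 T)) ∧
    -- the relation between the representatives
    ∀ fb g : ℝ → InverseWigner.PhaseSpaceL2 d,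
      InverseWigner.IsWignerSolution ε T Vb fb → fb 0 =ᵐ[volume] fI →
      InverseWigner.IsWignerSolution ε T Vb g → g T =ᵐ[volume] gT →
        -- as distributions
        ((2 * Real.pi * ε : ℂ) ^ d) • InverseWigner.wignerRep ε T fb g =
          InverseWigner.toDistribution
            ((inner ℂ (ψ' 0) φI' : ℂ) • InverseWigner.schrodingerRep ε T φb ψ -
              (inner ℂ (ψ 0) φI : ℂ) • InverseWigner.schrodingerRep ε T φb' ψ') ∧
        -- pointwise, whenever the oscillatory integral converges absolutely
        (Integrable (InverseWigner.wignerRepIntegrand ε T fb g 0) volume →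
          ∀ᵐ x : EuclideanSpace ℝ (Fin d),
            (2 * Real.pi * ε : ℂ) ^ d * InverseWigner.wignerRepAt ε T fb g x =
              ((inner ℂ (ψ' 0) φI' : ℂ) • InverseWigner.schrodingerRep ε T φb ψ -
                (inner ℂ (ψ 0) φI : ℂ) • InverseWigner.schrodingerRep ε T φb' ψ' :
                Lp ℂ 1 (volume : Measure (EuclideanSpace ℝ (Fin d)))) x) ∧
        -- the Wigner representative is a linear combination of Schrödinger representatives
        InverseWigner.wignerRep ε T fb g ∈
          Submodule.span ℂ (InverseWigner.schrodingerReps ε T Vb) := by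
  subst hφI hφI' hψT hψT' hfI hgT
  have hf := InverseWigner.isWignerSolution_wignerL2 hε hφb hψ'
  have hf0 := InverseWigner.coeFn_wignerL2 hε (φb 0) (ψ' 0)
  have hg := InverseWigner.isWignerSolution_wignerL2 hε hψ hφb'
  have hgT := InverseWigner.coeFn_wignerL2 hε (ψ T) (φb' T)
  have hf_unique := fun (f₁ : ℝ → InverseWigner.PhaseSpaceL2 d)
      (hf₁ : InverseWigner.IsWignerSolution ε T Vb f₁)
      (h₀ : f₁ 0 =ᵐ[volume] InverseWigner.wignerTransform ε (φb 0) (ψ' 0)) =>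
    hf₁.eqOn_of_eq hf (Set.left_mem_Icc.2 hT.le) (Lp.ext (h₀.trans hf0.symm))
  have hg_unique := fun (g₁ : ℝ → InverseWigner.PhaseSpaceL2 d)
      (hg₁ : InverseWigner.IsWignerSolution ε T Vb g₁)
      (h₁ : g₁ T =ᵐ[volume] InverseWigner.wignerTransform ε (ψ T) (φb' T)) =>
    hg₁.eqOn_of_eq hg (Set.right_mem_Icc.2 hT.le) (Lp.ext (h₁.trans hgT.symm))
  refine ⟨⟨_, ⟨hf, hf0⟩, hf_unique⟩, ⟨_, ⟨hg, hgT⟩, hg_unique⟩, fun f g hfsol hfI hgsol hgF => ?_⟩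
  have hrep := InverseWigner.wignerRep_of_eqOn_wignerL2 hε hT.le hφb hφb' hψ hψ'
    (hf_unique f hfsol hfI) (hg_unique g hgsol hgF)
  refine ⟨hrep, InverseWigner.ae_mul_wignerRepAt_eq hrep, ?_⟩
  have hconst : (2 * Real.pi * ε : ℂ) ^ d ≠ 0 :=
    pow_ne_zero _ (by simp [Real.pi_ne_zero, hε.ne'])
  rw [← Submodule.smul_mem_iff _ hconst, hrep, InverseWigner.toDistribution_smul_sub_smul]
  exact Submodule.sub_mem _
    (Submodule.smul_mem _ _ (Submodule.subset_span ⟨φb, ψ, hφb, hψ, rfl⟩))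
    (Submodule.smul_mem _ _ (Submodule.subset_span ⟨φb', ψ', hφb', hψ', rfl⟩))
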